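/- Let $\mathbb{K}$ be an algebraically closed field of characteristic zero, and let $p_1,\dots,p_4\in\mathbb{K}[t_1,t_2,t_3]$ be homogeneous polynomials of the same degree with $\gcd(p_1,\dots,p_4)=1$. They define a rational map $\mathcal{P}=(p_1:p_2:p_3:p_4)\colon\mathbb{P}^2(\mathbb{K})\dashrightarrow\mathbb{P}^3(\mathbb{K})$. Let $\mathscr{B}(\mathcal{P})=\{A\in\mathbb{P}^2(\mathbb{K}) : p_1(A)=p_2(A)=p_3(A)=p_4(A)=0\}$ be its set of base points. Let $\mathbb{F}$ be the algebraic closure of the rational function field $\mathbb{K}(x_1,\dots,x_4,y_1,\dots,y_4)$, and put $$W_1=\sum_{i=1}^4 x_i\,p_i(t_1,t_2,t_3),\qquad W_2=\sum_{i=1}^4 y_i\,p_i(t_1,t_2,t_3)\qquad\text{in } \mathbb{F}[t_1,t_2,t_3].$$ For $A\in\mathscr{B}(\mathcal{P})$, viewed as a point of $\mathbb{P}^2(\mathbb{F})$, let $$\mathrm{mult}_A(\mathscr{C}(W_1),\mathscr{C}(W_2))=\dim_{\mathbb{F}}\mathcal{O}_{\mathbb{P}^2(\mathbb{F}),A}/\langle\widetilde{W}_1,\widetilde{W}_2\rangle$$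 be the intersection multiplicity at $A$ of the plane curves $W_1=0$ and $W_2=0$ in $\mathbb{P}^2(\mathbb{F})$, where $\widetilde W_i$ is a local equation of $W_i$ at $A$, and put $$\mathrm{mult}(\mathscr{B}(\mathcal{P}))=\sum_{A\in\mathscr{B}(\mathcal{P})}\mathrm{mult}_A(\mathscr{C}(W_1),\mathscr{C}(W_2)).$$ Let $R_A=\mathcal{O}_{\mathbb{P}^2(\mathbb{K}),A}$, and let $I_A=\langle\tilde p_1,\tilde p_2,\tilde p_3,\tilde p_4\rangle\subset R_A$ be the ideal generated by local equations $\tilde p_i$ of the $p_i$ at $A$. The Hilbert–Samuel multiplicity $e(I,R)$ of an ideal $I$ in a local ring $R$ of dimension $d$ is the number $e$ such that, for all large $n$, the length of $R/I^{n+1}$ is finite and equal to a polynomial in $n$ of the form $\frac{e}{d!}\,n^d+(\text{terms of lower degree in } n)$. Then $\mathscr{B}(\mathcal{P})$ is finite, and for every $A\in\mathscr{B}(\mathcal{P})$ the Hilbert–Samuel multiplicity $e(I_A,R_A)$ exists and $$e(I_A,R_A)=\mathrm{mult}_A(\mathscr{C}(W_1),\mathscr{C}(W_2)).$$ Consequently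 $$\mathrm{mult}(\mathscr{B}(\mathcal{P}))=\sum_{A\in\mathscr{B}(\mathcal{P})}e(I_A,R_A).$$ -/

import Mathlib

open MvPolynomial Filter
open scoped LinearAlgebra.Projectivization Nat

universe u

attribute [local instance] MvPolynomial.gradedAlgebra

namespace BasePointMult

noncomputable section

/-! ### Hilbert–Samuel multiplicity -/

/-- `e` is the Hilbert–Samuel multiplicity `e(I, R)` of the ideal `I` in the local ring `R`:
for `n ≫ 0` the length of `R / I ^ (n + 1)` is finite and equal to
`(e / d!) n ^ d + (terms of lower degree in n)`, a polynomial in `n`, where `d = dim R`. -/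
def HasHilbertSamuelMultiplicity {R : Type*} [CommRing R] [IsLocalRing R]
    (I : Ideal R) (e : ℕ) : Prop :=
  ∃ (d : ℕ) (P : Polynomial ℚ), ringKrullDim R = d ∧ P.natDegree ≤ d ∧ P.coeff d * d ! = e ∧
    ∀ᶠ n : ℕ in atTop, ∃ l : ℕ, Module.length R (R ⧸ I ^ (n + 1)) = l ∧ (l : ℚ) = P.eval (n : ℚ)

/-- The Hilbert–Samuel multiplicity is unique. -/
theorem HasHilbertSamuelMultiplicity.unique {R : Type*} [CommRing R] [IsLocalRing R]
    {I : Ideal R} {e e' : ℕ} (h : HasHilbertSamuelMultiplicity I e)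
    (h' : HasHilbertSamuelMultiplicity I e') : e = e' := by
  obtain ⟨d, P, hd, -, hP, hn⟩ := h
  obtain ⟨d', P', hd', -, hP', hn'⟩ := h'
  have hdd : d = d' := by
    rw [hd] at hd'
    exact_mod_cast hd'
  subst hdd
  have key : ∀ᶠ n : ℕ in atTop, P.eval (n : ℚ) = P'.eval (n : ℚ) := by
    filter_upwards [hn, hn'] with n hl hl'
    obtain ⟨l, hl, hlP⟩ := hl
    obtain ⟨l', hl', hlP'⟩ := hl'
    rw [hl] at hl'
    have hll : l = l' := by exact_mod_cast hl'
    rw [← hlP, ← hlP', hll]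
  obtain ⟨N, hN⟩ := eventually_atTop.1 key
  have hPP : P = P' := by
    refine Polynomial.eq_of_infinite_eval_eq P P' ?_
    refine Set.infinite_of_injective_forall_mem (f := fun k : ℕ => ((N + k : ℕ) : ℚ)) ?_ ?_
    · intro a b hab
      have : N + a = N + b := Nat.cast_injective (R := ℚ) hab
      omega
    · intro k
      exact hN (N + k) (Nat.le_add_right N k)
  rw [hPP, hP'] at hP
  exact_mod_cast hP.symm

open scoped Classical in
/-- The Hilbert–Samuel multiplicity `e(I, R)` as a number (`0` if it does not exist). -/
def hilbertSamuelMultiplicity {R : Type*} [CommRing R] [IsLocalRing R] (I : Ideal R) : ℕ :=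
  if h : ∃ e : ℕ, HasHilbertSamuelMultiplicity I e then h.choose else 0

theorem HasHilbertSamuelMultiplicity.eq {R : Type*} [CommRing R] [IsLocalRing R]
    {I : Ideal R} {e : ℕ} (h : HasHilbertSamuelMultiplicity I e) :
    hilbertSamuelMultiplicity I = e := by
  have hex : ∃ e : ℕ, HasHilbertSamuelMultiplicity I e := ⟨e, h⟩
  rw [hilbertSamuelMultiplicity, dif_pos hex]
  exact hex.choose_spec.unique h

/-! ### The local rings of the projective plane -/

section Plane

variable {k : Type u} [Field k]

/-- The points of the projective plane over `k`. -/
abbrev Plane (k : Type u) [Field k] : Type u := ℙ k (Fin 3 → k)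

/-- The homogeneous ideal of a point `A` of the plane: it is generated by the homogeneous
polynomials that vanish at `A`. -/
def pointIdeal (A : Plane k) : HomogeneousIdeal (homogeneousSubmodule (Fin 3) k) :=
  (RingHom.ker (eval A.rep)).homogeneousCore (homogeneousSubmodule (Fin 3) k)

instance pointIdeal_isPrime (A : Plane k) : (pointIdeal A).toIdeal.IsPrime :=
  Ideal.IsPrime.homogeneousCore (RingHom.ker_isPrime (eval A.rep))

/-- The local ring `𝒪_{ℙ², A}`: fractions `f / s` of forms of the same degree in the homogeneous
coordinate ring, with `s` not vanishing at `A`. -/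
abbrev LocalRingAt (A : Plane k) : Type u :=
  HomogeneousLocalization.AtPrime (homogeneousSubmodule (Fin 3) k) (pointIdeal A).toIdeal

/-- The local ring at a point as an algebra over the ground field. -/
instance localRingAlgebra (A : Plane k) : Algebra k (LocalRingAt A) where
  algebraMap := (algebraMap (homogeneousSubmodule (Fin 3) k 0) (LocalRingAt A)).comp
    (algebraMap k (homogeneousSubmodule (Fin 3) k 0))
  commutes' _ _ := mul_comm _ _
  smul_def' c z := by
    apply HomogeneousLocalization.val_injective
    rw [HomogeneousLocalization.val_smul, HomogeneousLocalization.val_mul]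
    change c • z.val = Localization.mk (C c) 1 * z.val
    induction z.val using Localization.induction_on with
    | H y => rw [Localization.smul_mk, Localization.mk_mul, one_mul, smul_eq_C_mul]

/-- `z` is a local equation at `A` of the plane curve defined by the form `f`: it is `f / s` for
a form `s` of the same degree that does not vanish at `A`. -/
def IsLocalEquation (A : Plane k) (f : MvPolynomial (Fin 3) k) (z : LocalRingAt A) : Prop :=
  ∃ (d : ℕ) (hf : f ∈ homogeneousSubmodule (Fin 3) k d) (s : homogeneousSubmodule (Fin 3) k d)
    (hs : (s : MvPolynomial (Fin 3) k) ∈ (pointIdeal A).toIdeal.primeCompl),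
    z = HomogeneousLocalization.mk ⟨d, ⟨f, hf⟩, s, hs⟩

/-- The ideal of `𝒪_{ℙ², A}` generated by the local equations of the forms in `S`. (Two local
equations of the same form differ by a unit, so one may take one of them for each form.) -/
def localIdeal (A : Plane k) (S : Set (MvPolynomial (Fin 3) k)) : Ideal (LocalRingAt A) :=
  Ideal.span {z | ∃ f ∈ S, IsLocalEquation A f z}

/-- The intersection multiplicity at `A` of the plane curves defined by the forms `f` and `g`:
the dimension over `k` of `𝒪_{ℙ², A} / (f, g)`, which is `⊤` if that is infinite. -/
def intersectionMultiplicity (A : Plane k) (f g : MvPolynomial (Fin 3) k) : ℕ∞ :=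
  Cardinal.toENat (Module.rank k (LocalRingAt A ⧸ localIdeal A {f, g}))

/-- The inclusion of `k³` in `L³`, for a field extension `L` of `k`. -/
def extendVector (k : Type u) [Field k] (L : Type*) [Field L] [Algebra k L] :
    (Fin 3 → k) →ₛₗ[algebraMap k L] (Fin 3 → L) where
  toFun v i := algebraMap k L (v i)
  map_add' v w := by ext i; simp
  map_smul' c v := by ext i; simp

theorem extendVector_injective (k : Type u) [Field k] (L : Type*) [Field L] [Algebra k L] :
    Function.Injective (extendVector k L) := fun v w h => by
  ext i
  exact (algebraMap k L).injective (congrFun h i)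

/-- The inclusion of `ℙ²(k)` in `ℙ²(L)`, for a field extension `L` of `k`. -/
def extendPoint (L : Type u) [Field L] [Algebra k L] (A : Plane k) : Plane L :=
  Projectivization.map (extendVector k L) (extendVector_injective k L) A

end Plane

/-! ### Base points of a parametrization -/

section Parametrization

variable {K : Type u} [Field K]

/-- The algebraic closure `𝔽` of the field `K(x₁, …, x₄, y₁, …, y₄)`. -/
abbrev GenericField (K : Type u) [Field K] : Type u :=
  AlgebraicClosure (FractionRing (MvPolynomial (Fin 4 ⊕ Fin 4) K))

/-- The indeterminate `x_i` (for `j = inl i`) or `y_i` (for `j = inr i`) as an element of `𝔽`. -/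
def indeterminate (K : Type u) [Field K] (j : Fin 4 ⊕ Fin 4) : GenericField K :=
  algebraMap (FractionRing (MvPolynomial (Fin 4 ⊕ Fin 4) K)) (GenericField K)
    (algebraMap (MvPolynomial (Fin 4 ⊕ Fin 4) K) _ (X j))

/-- `W₁ = x₁ p₁ + x₂ p₂ + x₃ p₃ + x₄ p₄`. -/
def W₁ (p : Fin 4 → MvPolynomial (Fin 3) K) : MvPolynomial (Fin 3) (GenericField K) :=
  ∑ i, C (indeterminate K (Sum.inl i)) * map (algebraMap K (GenericField K)) (p i)

/-- `W₂ = y₁ p₁ + y₂ p₂ + y₃ p₃ + y₄ p₄`. -/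
def W₂ (p : Fin 4 → MvPolynomial (Fin 3) K) : MvPolynomial (Fin 3) (GenericField K) :=
  ∑ i, C (indeterminate K (Sum.inr i)) * map (algebraMap K (GenericField K)) (p i)

/-- The base points of `(p₁ : p₂ : p₃ : p₄)`: the common zeros of the `p_i` in `ℙ²(K)`. -/
def basePoints (p : Fin 4 → MvPolynomial (Fin 3) K) : Set (Plane K) :=
  {A | ∀ i, eval A.rep (p i) = 0}

/-- The multiplicity of a base point `A`: the intersection multiplicity at `A` of the curves
defined by `W₁` and `W₂` in `ℙ²(𝔽)`. -/
def basePointMultiplicity (p : Fin 4 → MvPolynomial (Fin 3) K) (A : Plane K) : ℕ∞ :=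
  intersectionMultiplicity (extendPoint (GenericField K) A) (W₁ p) (W₂ p)

/-- The multiplicity of the base point locus: the sum of the multiplicities of the base points. -/
def baseLocusMultiplicity (p : Fin 4 → MvPolynomial (Fin 3) K) : ℕ∞ :=
  ∑ᶠ A ∈ basePoints p, basePointMultiplicity p A

/-- The ideal `I_A` of `R_A = 𝒪_{ℙ²(K), A}` generated by local equations of `p₁, …, p₄`. -/
def baseIdeal (p : Fin 4 → MvPolynomial (Fin 3) K) (A : Plane K) : Ideal (LocalRingAt A) :=
  localIdeal A (Set.range p)

end Parametrization

end

end BasePointMult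

namespace BasePointMult

noncomputable section

/-! ### Colon ideals of large powers -/

section RatliffRush

variable {S : Type*} [CommRing S]

/-! In an affine chart centred at a base point, the local rings over `K` and over `F` become the
localizations `R` and `S` of the polynomial rings in two variables at the origin. The gcd condition
excludes a common component, so the ideal `I` of the base point is primary for the maximal ideal. `R
→ S` is flat and local and carries the maximal ideal to the maximal ideal, so `R / I ^ n` and `S /
(I S) ^ n` have the same length, and everything can be computed in `S`.

The heart is that `J = (W₁, W₂)` is a reduction: `(I S) ^ (c + 1) = J (I S) ^ c`
(`exists_pow_succ_eq_of_generic`). The forms `g` over `K` in four variables whose value at the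
generators lies in `I ^ (deg g + 1)` cut out a set of dimension at most one in projective 3-space:
three independent directions would give cubically many independent elements in quotients `R / I ^ n`
of quadratic dimension (`false_of_independent_forms`). Two generic planes miss such a set, by a
count of transcendence degrees (`false_of_generic_incidence`). The Nullstellensatz turns the absence
of common zeros into `(I S) ^ (c + 1) ≤ (I S) ^ (c + 2) + J (I S) ^ c`, and Nakayama's lemma removes
the first summand.

As `J` has finite colength in a factorial local ring of dimension two, its generators form a regular
sequence. The Koszul complex then yields an exact sequence between the quotients by successive
powers; its injectivity on the left is `(I S) ^ (n + 1) : J = (I S) ^ n` for large `n`, a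
consequence of Artin–Rees. Hence the second difference of the length of `S / (I S) ^ n` is
eventually the colength of `J`, and this constant is the Hilbert–Samuel multiplicity. -/

theorem mem_smul_top_prod_iff (I : Ideal S) (x : S × S) :
    x ∈ I • (⊤ : Submodule S (S × S)) ↔ x.1 ∈ I ∧ x.2 ∈ I := by
  constructor
  · intro h
    have h1 : Submodule.map (LinearMap.fst S S S) (I • ⊤) ≤ I := by
      rw [Submodule.map_smul'']
      exact Submodule.smul_le.2 fun r hr x _ => I.mul_mem_right x hr
    have h2 : Submodule.map (LinearMap.snd S S S) (I • ⊤) ≤ I := by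
      rw [Submodule.map_smul'']
      exact Submodule.smul_le.2 fun r hr x _ => I.mul_mem_right x hr
    exact ⟨h1 (Submodule.mem_map_of_mem h), h2 (Submodule.mem_map_of_mem h)⟩
  · rintro ⟨h1, h2⟩
    have : x = x.1 • ((1, 0) : S × S) + x.2 • ((0, 1) : S × S) := by ext <;> simp
    rw [this]
    exact add_mem (Submodule.smul_mem_smul h1 trivial) (Submodule.smul_mem_smul h2 trivial)

/-- If `(a, b)` is a reduction of `I` and `a` is regular, then `I ^ (n + 1) : (a, b) = I ^ n` for
all large `n`. -/
theorem exists_forall_mem_pow_of_mul_mem_pow_succ [IsNoetherianRing S] {I : Ideal S} {a b : S}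
    {c : ℕ} (ha : ∀ z, z * a = 0 → z = 0) (hred : I ^ (c + 1) = Ideal.span {a, b} * I ^ c) :
    ∃ N, ∀ n ≥ N, ∀ z, z * a ∈ I ^ (n + 1) → z * b ∈ I ^ (n + 1) → z ∈ I ^ n := by
  set ι : S →ₗ[S] S × S := LinearMap.toSpanSingleton S (S × S) (a, b) with hι
  have hιz (z : S) : ι z = (z * a, z * b) := rfl
  have hιi : Function.Injective ι := by
    rw [injective_iff_map_eq_zero]
    intro z hz
    rw [hιz] at hz
    exact ha z (congrArg Prod.fst hz)
  have hred' (k : ℕ) (hk : c + 1 ≤ k) : I ^ k = Ideal.span {a, b} * I ^ (k - 1) := by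
    obtain ⟨t, rfl⟩ := Nat.exists_eq_add_of_le hk
    rw [pow_add, hred, mul_assoc, ← pow_add]
    congr 2
    omega
  -- Artin–Rees for the submodule of all pairs `(z * a, z * b)` in `S × S`.
  obtain ⟨n₀, hn₀⟩ := ((I.stableFiltration_stable ⊤).inter_right
    (I.trivialFiltration (LinearMap.range ι))).exists_pow_smul_eq_of_ge
  refine ⟨n₀ + c + 1, fun n hn z hza hzb => ?_⟩
  set G : Ideal S := Submodule.comap ι (I ^ n₀ • ⊤)
  have hN : (I ^ n₀ • (⊤ : Submodule S (S × S))) ⊓ LinearMap.range ι = Submodule.map ι G := by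
    rw [Submodule.map_comap_eq, inf_comm]
  have hz : ι z ∈ I ^ (n + 1 - n₀) • Submodule.map ι G := by
    rw [← hN]
    have := hn₀ (n + 1) (by omega)
    simp only [Ideal.Filtration.inf_N, Pi.inf_apply, Ideal.stableFiltration_N,
      Ideal.trivialFiltration_N] at this
    rw [← this]
    exact ⟨(mem_smul_top_prod_iff _ _).2 ⟨hza, hzb⟩, ⟨z, rfl⟩⟩
  rw [← Submodule.map_smul''] at hz
  obtain ⟨z', hz', hzz⟩ := hz
  obtain rfl := hιi hzz
  -- One factor `I` is traded for `(a, b)`. An element `s` of `I ^ (n - n₀) * G` has `s * a` and `s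
  -- * b` in `I ^ n`, so its product with any element of `(a, b)` is in `I ^ n`.
  rw [smul_eq_mul, hred' _ (by omega), mul_assoc] at hz'
  refine (Ideal.mul_le.2 fun r hr s hs => ?_ :
    Ideal.span {a, b} * (I ^ (n + 1 - n₀ - 1) * G) ≤ I ^ n) hz'
  have hs' : ι s ∈ I ^ n • (⊤ : Submodule S (S × S)) := by
    have h1 : ι s ∈ Submodule.map ι (I ^ (n + 1 - n₀ - 1) • G) := Submodule.mem_map_of_mem hs
    rw [Submodule.map_smul''] at h1
    have h2 : I ^ (n + 1 - n₀ - 1) • Submodule.map ι G ≤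
        I ^ (n + 1 - n₀ - 1) • (I ^ n₀ • (⊤ : Submodule S (S × S))) :=
      Submodule.smul_mono le_rfl (Submodule.map_comap_le _ _)
    have h3 := h2 h1
    rw [← Submodule.mul_smul, ← pow_add] at h3
    convert h3 using 3
    omega
  rw [mem_smul_top_prod_iff, hιz] at hs'
  obtain ⟨u, v, rfl⟩ := Ideal.mem_span_pair.1 hr
  have : (u * a + v * b) * s = u * (s * a) + v * (s * b) := by ring
  rw [this]
  exact add_mem (Ideal.mul_mem_left _ _ hs'.1) (Ideal.mul_mem_left _ _ hs'.2)

end RatliffRush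

/-! ### The Koszul sequence and lengths -/

section LengthRecursion

variable {S : Type*} [CommRing S]

/-- The length recursion given by the exact sequence
`0 → S / I ^ n → (S / I ^ (n + 1))² → S / I ^ (n + 2) → S / (a, b) → 0`. -/
theorem length_quotient_pow_add {I : Ideal S} {a b : S} {n : ℕ}
    (hreg : ∀ x y, x * a + y * b = 0 → ∃ z, x = z * b ∧ y = -(z * a))
    (haI : a ∈ I) (hbI : b ∈ I)
    (hpow : I ^ (n + 2) = Ideal.span {a, b} * I ^ (n + 1))
    (hcolon : ∀ z, z * a ∈ I ^ (n + 1) → z * b ∈ I ^ (n + 1) → z ∈ I ^ n) :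
    Module.length S (S ⧸ I ^ (n + 2)) + Module.length S (S ⧸ I ^ n) =
      Module.length S (S ⧸ I ^ (n + 1)) + Module.length S (S ⧸ I ^ (n + 1)) +
        Module.length S (S ⧸ Ideal.span {a, b}) := by
  set J := Ideal.span {a, b} with hJ
  have haJ : a ∈ J := Ideal.subset_span (by simp)
  have hbJ : b ∈ J := Ideal.subset_span (by simp)
  have hle (x : S) (hx : x ∈ I) (m : ℕ) (y : S) (hy : y ∈ I ^ m) : x * y ∈ I ^ (m + 1) := by
    rw [pow_succ']
    exact Ideal.mul_mem_mul hx hy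
  let mulMap (x : S) (hx : x ∈ I) (m : ℕ) : (S ⧸ I ^ m) →ₗ[S] (S ⧸ I ^ (m + 1)) :=
    Submodule.mapQ (I ^ m) (I ^ (m + 1)) (LinearMap.mulLeft S x) (fun y hy => hle x hx m y hy)
  have mulMap_mk (x : S) (hx : x ∈ I) (m : ℕ) (y : S) :
      mulMap x hx m (Ideal.Quotient.mk _ y) = Ideal.Quotient.mk _ (x * y) := rfl
  let α : (S ⧸ I ^ n) →ₗ[S] (S ⧸ I ^ (n + 1)) × (S ⧸ I ^ (n + 1)) :=
    (mulMap b hbI n).prod (-mulMap a haI n)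
  let β : (S ⧸ I ^ (n + 1)) × (S ⧸ I ^ (n + 1)) →ₗ[S] (S ⧸ I ^ (n + 2)) :=
    (mulMap a haI (n + 1)).coprod (mulMap b hbI (n + 1))
  have hle' : I ^ (n + 2) ≤ J := by
    rw [hpow]
    exact Ideal.mul_le_left
  let γ : (S ⧸ I ^ (n + 2)) →ₗ[S] (S ⧸ J) := Submodule.factor hle'
  have α_mk (z : S) : α (Ideal.Quotient.mk _ z) =
      (Ideal.Quotient.mk _ (b * z), Ideal.Quotient.mk _ (-(a * z))) := rfl
  have β_mk (x y : S) : β (Ideal.Quotient.mk _ x, Ideal.Quotient.mk _ y) =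
      Ideal.Quotient.mk _ (a * x + b * y) := rfl
  have hα : Function.Injective α := by
    rw [injective_iff_map_eq_zero]
    intro z hz
    obtain ⟨z, rfl⟩ := Ideal.Quotient.mk_surjective z
    rw [α_mk, Prod.mk_eq_zero, Ideal.Quotient.eq_zero_iff_mem, Ideal.Quotient.eq_zero_iff_mem,
      neg_mem_iff] at hz
    obtain ⟨h1, h2⟩ := hz
    rw [Ideal.Quotient.eq_zero_iff_mem]
    exact hcolon z (by rwa [mul_comm]) (by rwa [mul_comm])
  have hαβ : Function.Exact α β := by
    rintro ⟨x, y⟩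
    obtain ⟨x, rfl⟩ := Ideal.Quotient.mk_surjective x
    obtain ⟨y, rfl⟩ := Ideal.Quotient.mk_surjective y
    constructor
    · intro h
      rw [β_mk, Ideal.Quotient.eq_zero_iff_mem, hpow] at h
      obtain ⟨x', hx', y', hy', h⟩ : ∃ x' ∈ I ^ (n + 1), ∃ y' ∈ I ^ (n + 1),
          x' * a + y' * b = a * x + b * y := by
        rw [hJ, Ideal.span_insert, Ideal.sup_mul] at h
        obtain ⟨u, hu, v, hv, huv⟩ := Submodule.mem_sup.1 h
        obtain ⟨x', hx', rfl⟩ := Ideal.mem_span_singleton_mul.1 hu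
        obtain ⟨y', hy', rfl⟩ := Ideal.mem_span_singleton_mul.1 hv
        exact ⟨x', hx', y', hy', by rw [← huv]; ring⟩
      -- The difference of the two representations is a syzygy of `(a, b)`, hence a Koszul syzygy.
      obtain ⟨z, hz1, hz2⟩ := hreg (x - x') (y - y') (by linear_combination -h)
      refine ⟨Ideal.Quotient.mk _ z, ?_⟩
      rw [α_mk]
      refine Prod.ext ?_ ?_
      · simp only
        rw [Ideal.Quotient.eq]
        have : b * z - x = -x' := by linear_combination -hz1
        rw [this]
        exact neg_mem hx'
      · simp only
        rw [Ideal.Quotient.eq]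
        have : -(a * z) - y = -y' := by linear_combination -hz2
        rw [this]
        exact neg_mem hy'
    · rintro ⟨z, hz⟩
      obtain ⟨z, rfl⟩ := Ideal.Quotient.mk_surjective z
      rw [← hz, α_mk, β_mk, Ideal.Quotient.eq_zero_iff_mem]
      have : a * (b * z) + b * -(a * z) = 0 := by ring
      rw [this]
      exact zero_mem _
  have hβγ : LinearMap.ker γ = LinearMap.range β := by
    ext w
    obtain ⟨w, rfl⟩ := Ideal.Quotient.mk_surjective w
    have hγw : γ (Ideal.Quotient.mk _ w) = Ideal.Quotient.mk _ w := rfl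
    rw [LinearMap.mem_ker, hγw, Ideal.Quotient.eq_zero_iff_mem]
    constructor
    · intro hw
      obtain ⟨x, y, rfl⟩ := Ideal.mem_span_pair.1 hw
      refine ⟨(Ideal.Quotient.mk _ x, Ideal.Quotient.mk _ y), ?_⟩
      rw [β_mk]
      congr 1
      ring
    · rintro ⟨⟨x, y⟩, hxy⟩
      obtain ⟨x, rfl⟩ := Ideal.Quotient.mk_surjective x
      obtain ⟨y, rfl⟩ := Ideal.Quotient.mk_surjective y
      rw [β_mk] at hxy
      have h1 : Ideal.Quotient.mk J (a * x + b * y) = Ideal.Quotient.mk J w := congrArg γ hxy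
      rw [← Ideal.Quotient.eq_zero_iff_mem, ← h1, Ideal.Quotient.eq_zero_iff_mem]
      exact add_mem (Ideal.mul_mem_right _ _ haJ) (Ideal.mul_mem_right _ _ hbJ)
  have hγ : Function.Surjective γ := Submodule.factor_surjective _
  -- The four-term sequence is cut at the image of `β` into two short exact ones.
  have e1 := Module.length_eq_add_of_exact α β.rangeRestrict hα β.surjective_rangeRestrict
    (by
      intro x
      rw [← hαβ x, ← Subtype.val_inj]
      rfl)
  have e2 := Module.length_eq_add_of_exact (LinearMap.range β).subtype γ
    (Submodule.subtype_injective _) hγ (by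
      rw [LinearMap.exact_iff, hβγ, Submodule.range_subtype])
  rw [Module.length_prod] at e1
  rw [e2, e1]
  abel

end LengthRecursion

/-! ### From a constant second difference to the Hilbert–Samuel polynomial -/

section HilbertSamuel

theorem eq_of_second_difference {f : ℕ → ℚ} {N : ℕ} {μ : ℚ}
    (h : ∀ n ≥ N, f (n + 2) + f n = f (n + 1) + f (n + 1) + μ) (m : ℕ) :
    f (N + m) = f N + m * (f (N + 1) - f N) + μ * (m * (m - 1) / 2) := by
  induction m using Nat.strong_induction_on with
  | _ m ih =>
    match m with
    | 0 => simp
    | 1 => simp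
    | m + 2 =>
      have h0 := ih m (by omega)
      have h1 := ih (m + 1) (by omega)
      have h2 := h (N + m) (by omega)
      have : f (N + (m + 2)) = f (N + (m + 1)) + f (N + (m + 1)) + μ - f (N + m) := by
        rw [eq_sub_iff_add_eq]; exact h2
      rw [this, h0, h1]
      push_cast
      ring

theorem hasHilbertSamuelMultiplicity_of_second_difference {R : Type*} [CommRing R]
    [IsLocalRing R] {I : Ideal R} {e N : ℕ} (hdim : ringKrullDim R = 2) (f : ℕ → ℕ)
    (hf : ∀ n, Module.length R (R ⧸ I ^ n) = f n)
    (h : ∀ n ≥ N, f (n + 2) + f n = f (n + 1) + f (n + 1) + e) :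
    HasHilbertSamuelMultiplicity I e := by
  set A : ℚ := (f (N + 1) : ℚ) - f N
  -- The formula of `eq_of_second_difference` at `m = n + 1 - N`, expanded in powers of `n`; the
  -- shift by one is there because the multiplicity is read off from `I ^ (n + 1)`.
  set P : Polynomial ℚ := Polynomial.C ((e : ℚ) / 2) * Polynomial.X ^ 2 +
    Polynomial.C (A + e * (1 / 2 - N)) * Polynomial.X + Polynomial.C (f N + A * (1 - N) + e * (1 - N) * (- N) / 2)
  have hcoeff : P.coeff 2 = (e : ℚ) / 2 := by
    simp only [P, Polynomial.coeff_add, Polynomial.coeff_C_mul, Polynomial.coeff_X_pow,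
      Polynomial.coeff_X, Polynomial.coeff_C]
    norm_num
  have hdeg : P.natDegree ≤ 2 := by
    simp only [P]
    compute_degree
  refine ⟨2, P, by simpa using hdim, hdeg, ?_, ?_⟩
  · rw [hcoeff]
    norm_num [Nat.factorial]
  · filter_upwards [eventually_ge_atTop N] with n hn
    refine ⟨f (n + 1), hf _, ?_⟩
    obtain ⟨m, rfl⟩ := Nat.exists_eq_add_of_le hn
    have := eq_of_second_difference (f := fun n => (f n : ℚ)) (N := N) (μ := e)
      (fun n hn => by exact_mod_cast h n hn) (m + 1)
    rw [add_assoc, this]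
    simp only [P, Polynomial.eval_add, Polynomial.eval_mul, Polynomial.eval_C, Polynomial.eval_pow,
      Polynomial.eval_X]
    push_cast
    ring

end HilbertSamuel

/-! ### A reduction criterion from the Nullstellensatz -/

section Reduction

theorem aeval_mul_of_isHomogeneous {σ k S : Type*} [CommRing k] [CommRing S] [Algebra k S]
    {f : MvPolynomial σ k} {d : ℕ} (hf : f.IsHomogeneous d) (v : σ → S) (c : S) :
    aeval (fun i => v i * c) f = aeval v f * c ^ d := by
  rw [aeval_def, aeval_def, eval₂_eq, eval₂_eq, Finset.sum_mul]
  refine Finset.sum_congr rfl fun m hm => ?_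
  rw [mul_assoc]
  congr 1
  simp only [mul_pow]
  rw [Finset.prod_mul_distrib, Finset.prod_pow_eq_pow_sum]
  congr 2
  rw [← hf.degree_eq_sum_deg_support hm]

variable {σ F S : Type*} [Field F] [CommRing S] [Algebra F S]

/-- The substitution of `q i * T` for the variables lands in the Rees algebra. The variable `T`
records degrees, so elements of an ideal that are not homogeneous can be treated degree by degree.
-/
theorem coeff_aeval_C_mul_X_mem_pow (q : σ → S) (g : MvPolynomial σ F) (m : ℕ) :
    (aeval (fun i => Polynomial.C (q i) * Polynomial.X) g : Polynomial S).coeff m ∈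
      Ideal.span (Set.range q) ^ m := by
  have : (aeval (fun i => Polynomial.C (q i) * Polynomial.X) g : Polynomial S) ∈
      reesAlgebra (Ideal.span (Set.range q)) := by
    induction g using MvPolynomial.induction_on with
    | C a =>
      rw [algHom_C, IsScalarTower.algebraMap_apply F S (Polynomial S)]
      exact Subalgebra.algebraMap_mem _ _
    | add p r hp hr =>
      rw [map_add]
      exact add_mem hp hr
    | mul_X p i hp =>
      rw [map_mul, aeval_X]
      refine mul_mem hp ?_
      rw [← Polynomial.monomial_one_one_eq_X, Polynomial.C_mul_monomial, mul_one]
      exact reesAlgebra.monomial_mem.2 (by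
        rw [pow_one]
        exact Ideal.subset_span ⟨i, rfl⟩)
  exact (mem_reesAlgebra_iff _ _).1 this m

theorem aeval_C_mul_X_of_isHomogeneous (q : σ → S) {g : MvPolynomial σ F} {d : ℕ}
    (hg : g.IsHomogeneous d) :
    (aeval (fun i => Polynomial.C (q i) * Polynomial.X) g : Polynomial S) =
      Polynomial.C (aeval q g) * Polynomial.X ^ d := by
  rw [aeval_mul_of_isHomogeneous hg]
  congr 1
  change _ = algebraMap S (Polynomial S) _
  rw [← aeval_algebraMap_apply]
  rfl

theorem aeval_mem_pow_of_isHomogeneous (q : σ → S) {I : Ideal S} (hq : ∀ i, q i ∈ I)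
    {g : MvPolynomial σ F} {d : ℕ} (hg : g.IsHomogeneous d) : aeval q g ∈ I ^ d := by
  have h := coeff_aeval_C_mul_X_mem_pow q g d
  rw [aeval_C_mul_X_of_isHomogeneous q hg, Polynomial.coeff_C_mul_X_pow, if_pos rfl] at h
  refine Ideal.pow_right_mono (Ideal.span_le.2 ?_) d h
  rintro _ ⟨i, rfl⟩
  exact hq i

/-- If the forms `g` with `g(q) ∈ I ^ (deg g + 1) + J I ^ (deg g - 1)` have no common zero besides
the origin, where `I` is the ideal generated by the `q i`, then `I ^ (n + 1) = J I ^ n` up to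
`I ^ (n + 2)`. -/
theorem exists_pow_succ_le_of_forall_eval_eq_zero [IsAlgClosed F] [Finite σ] (q : σ → S)
    (J : Ideal S) (G : Set (MvPolynomial σ F))
    (hG : ∀ g ∈ G, ∃ d, g.IsHomogeneous d ∧ aeval q g ∈
      Ideal.span (Set.range q) ^ (d + 1) ⊔ J * Ideal.span (Set.range q) ^ (d - 1))
    (hzero : ∀ c : σ → F, (∀ g ∈ G, eval c g = 0) → c = 0) :
    ∃ n, Ideal.span (Set.range q) ^ (n + 1) ≤
      Ideal.span (Set.range q) ^ (n + 2) ⊔ J * Ideal.span (Set.range q) ^ n := by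
  set I := Ideal.span (Set.range q) with hI
  let Φ : MvPolynomial σ F →ₐ[F] Polynomial S :=
    aeval (fun i => Polynomial.C (q i) * Polynomial.X)
  have hΦ {g : MvPolynomial σ F} {d : ℕ} (hg : g.IsHomogeneous d) :
      Φ g = Polynomial.C (aeval q g) * Polynomial.X ^ d := aeval_C_mul_X_of_isHomogeneous q hg
  -- In degree `0` the truncated subtraction gives `I ⊔ J`, and multiplication by `I ^ i` still
  -- raises the index by `i`.
  let b (m : ℕ) : Ideal S := I ^ (m + 1) ⊔ J * I ^ (m - 1)
  have hb (i j : ℕ) (x y : S) (hx : x ∈ I ^ i) (hy : y ∈ b j) : x * y ∈ b (i + j) := by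
    have h1 : I ^ i * b j ≤ b (i + j) := by
      simp only [b, Ideal.mul_sup]
      refine sup_le_sup ?_ ?_
      · rw [← pow_add, add_assoc]
      · rw [← mul_assoc, mul_comm (I ^ i), mul_assoc, ← pow_add]
        exact Ideal.mul_mono_right (Ideal.pow_le_pow_right (by omega))
    exact h1 (Ideal.mul_mem_mul hx hy)
  have hspan (g : MvPolynomial σ F) (hg : g ∈ Ideal.span G) (m : ℕ) : (Φ g).coeff m ∈ b m := by
    induction hg using Submodule.span_induction generalizing m with
    | mem g hg =>
      obtain ⟨d, hd, hgd⟩ := hG g hg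
      rw [hΦ hd, Polynomial.coeff_C_mul_X_pow]
      split_ifs with h
      · rw [h]
        exact hgd
      · exact zero_mem _
    | zero =>
      rw [map_zero]
      exact zero_mem _
    | add x y _ _ hx hy =>
      rw [map_add, Polynomial.coeff_add]
      exact add_mem (hx m) (hy m)
    | smul h x _ hx =>
      rw [smul_eq_mul, map_mul, Polynomial.coeff_mul]
      refine Ideal.sum_mem _ fun ij hij => ?_
      rw [← Finset.HasAntidiagonal.mem_antidiagonal.1 hij]
      exact hb _ _ _ _ (coeff_aeval_C_mul_X_mem_pow q h _) (hx _)
  -- By the Nullstellensatz, some power of every variable lies in the ideal generated by `G`.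
  have hrad : idealOfVars σ F ≤ (Ideal.span G).radical := by
    rw [← vanishingIdeal_zeroLocus_eq_radical (K := F), Ideal.span_le]
    rintro _ ⟨i, rfl⟩
    rw [SetLike.mem_coe, mem_vanishingIdeal_iff]
    intro c hc
    have := hzero c fun g hg => by
      have := mem_zeroLocus_iff.1 hc g (Ideal.subset_span hg)
      simpa [aeval_eq_eval] using this
    simp [this]
  obtain ⟨n, hn⟩ := Ideal.exists_pow_le_of_le_radical_of_fg hrad (idealOfVars_fg σ F)
  refine ⟨n, fun x hx => ?_⟩
  -- It suffices to treat monomials of degree `n + 1` in the `q i`, and these monomials already lie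
  -- in the ideal generated by `G`.
  obtain ⟨p, hp, rfl⟩ := (Ideal.mem_span_pow_iff_exists_isHomogeneous q x).1 hx
  rw [eval_eq]
  refine Ideal.sum_mem _ fun m hm => Ideal.mul_mem_left _ _ ?_
  have hmdeg : m.degree = n + 1 := (hp.degree_eq_sum_deg_support hm).symm
  have hmon : (monomial m (1 : F)).IsHomogeneous (n + 1) := isHomogeneous_monomial _ hmdeg
  have hmem := hspan (monomial m 1) (hn (Ideal.pow_le_pow_right n.le_succ
    ((monomial_mem_pow_idealOfVars_iff _ _ one_ne_zero).2 hmdeg.ge))) (n + 1)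
  rw [hΦ hmon, Polynomial.coeff_C_mul_X_pow, if_pos rfl, aeval_monomial, map_one, one_mul] at hmem
  exact hmem

end Reduction

/-! ### Two generic planes miss a curve -/

section TranscendenceDegree

open Algebra in
-- A dimension count. The point `c` has transcendence degree at most one, and each incidence
-- expresses the `j`-th coefficient of a plane by the other three and `c`. Eight independent
-- elements would thus be algebraic over six of them and one coordinate ratio.
theorem false_of_generic_incidence {K F : Type*} [Field K] [Field F] [Algebra K F]
    {x : Fin 4 ⊕ Fin 4 → F} (hx : AlgebraicIndependent K x) {c : Fin 4 → F} {j : Fin 4}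
    (hcj : c j ≠ 0)
    (hdep : ∀ a b, Transcendental K (c a / c j) →
      IsAlgebraic (adjoin K {c a / c j}) (c b / c j))
    (h1 : ∑ i, x (Sum.inl i) * c i = 0) (h2 : ∑ i, x (Sum.inr i) * c i = 0) : False := by
  obtain ⟨k, hk⟩ : ∃ k, ∀ b, IsAlgebraic (adjoin K {c k / c j}) (c b / c j) := by
    by_cases h : ∃ k, Transcendental K (c k / c j)
    · obtain ⟨k, hk⟩ := h
      exact ⟨k, fun b => hdep k b hk⟩
    · push Not at h
      -- All ratios are algebraic over `K`, so any index serves.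
      exact ⟨0, fun b => (not_not.1 (h b)).extendScalars (FaithfulSMul.algebraMap_injective _ _)⟩
  let T : Finset (Fin 4 ⊕ Fin 4) := (Finset.univ.erase (Sum.inl j)).erase (Sum.inr j)
  let s : Set F := insert (c k / c j) (x '' T)
  have hs : s.encard ≤ 7 := by
    refine (Set.encard_insert_le _ _).trans ?_
    have : (x '' T).encard ≤ 6 := by
      refine (Set.encard_image_le _ _).trans ?_
      rw [Set.encard_coe_eq_coe_finsetCard]
      have : T.card = 6 := by
        simp [T, Finset.card_erase_of_mem]
      rw [this, Nat.cast_ofNat]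
    calc _ ≤ (6 : ℕ∞) + 1 := by gcongr
      _ = 7 := by norm_num
  let A := Subalgebra.algebraicClosure (adjoin K s) F
  have hc (b : Fin 4) : c b / c j ∈ A := by
    have hsub := (AlgebraicIndependent.matroid K F).closure_subset_closure
      (Set.singleton_subset_iff.2 (Set.mem_insert (c k / c j) (x '' T)))
    rw [AlgebraicIndependent.matroid_closure_eq, AlgebraicIndependent.matroid_closure_eq] at hsub
    exact hsub ((Subalgebra.mem_algebraicClosure _ _).2 (hk b))
  have hxT (t) (ht : t ∈ T) : x t ∈ A := by
    rw [Subalgebra.mem_algebraicClosure]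
    exact isAlgebraic_algebraMap (⟨x t, subset_adjoin
      (Set.mem_insert_of_mem _ ⟨t, ht, rfl⟩)⟩ : adjoin K s)
  have hsum (y : Fin 4 → F) (hy : ∀ i ≠ j, y i ∈ A) (h : ∑ i, y i * c i = 0) : y j ∈ A := by
    have hyj : y j = -∑ i ∈ Finset.univ.erase j, y i * (c i / c j) := by
      rw [← Finset.add_sum_erase _ _ (Finset.mem_univ j)] at h
      simp only [← mul_div_assoc]
      rw [← Finset.sum_div, eq_neg_iff_add_eq_zero]
      field_simp
      rw [mul_zero]
      exact h
    rw [hyj]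
    exact neg_mem (sum_mem fun i hi => mul_mem (hy i (Finset.ne_of_mem_erase hi)) (hc i))
  have hall : Set.range x ⊆ (AlgebraicIndependent.matroid K F).closure s := by
    rw [AlgebraicIndependent.matroid_closure_eq]
    rintro _ ⟨t, rfl⟩
    by_cases ht : t ∈ T
    · exact hxT t ht
    · have : t = Sum.inl j ∨ t = Sum.inr j := by
        by_contra hcon
        push Not at hcon
        exact ht (by simp [T, hcon])
      rcases this with rfl | rfl
      · exact hsum (fun i => x (Sum.inl i)) (fun i hi => hxT _ (by simp [T, hi])) h1
      · exact hsum (fun i => x (Sum.inr i)) (fun i hi => hxT _ (by simp [T, hi])) h2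
  have hind : (AlgebraicIndependent.matroid K F).Indep (Set.range x) :=
    AlgebraicIndependent.matroid_indep_iff.2 hx.coe_range
  have h8 : (Set.range x).encard = 8 := by
    rw [← Set.image_univ, hx.injective.encard_image, Set.encard_univ]
    simp
  have h := (hind.encard_le_eRk_of_subset hall).trans
    (((AlgebraicIndependent.matroid K F).eRk_closure_eq s).trans_le
      ((Matroid.eRk_le_encard _ _).trans hs))
  rw [h8] at h
  exact absurd h (by norm_num)

end TranscendenceDegree

/-! ### The local ring of the plane at the origin -/

section Origin

variable {L : Type*} [Field L]

theorem mem_idealOfVars_iff {σ : Type*} (f : MvPolynomial σ L) :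
    f ∈ idealOfVars σ L ↔ constantCoeff f = 0 := by
  have := mem_pow_idealOfVars_iff' 1 f
  rw [pow_one] at this
  rw [this]
  constructor
  · intro h
    exact h 0 (by simp)
  · intro h x hx
    obtain rfl : x = 0 := by
      rw [← Finsupp.degree_eq_zero_iff]
      omega
    exact h

instance idealOfVars_isMaximal {σ : Type*} : (idealOfVars σ L).IsMaximal := by
  have : idealOfVars σ L = RingHom.ker (constantCoeff (σ := σ) (R := L)) := by
    ext f
    rw [mem_idealOfVars_iff, RingHom.mem_ker]
  rw [this]
  exact RingHom.ker_isMaximal_of_surjective _ fun c => ⟨C c, constantCoeff_C _ _⟩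

/-- A nonzero prime of a factorial ring contains a prime element `π`. It cannot be generated by `π`,
which would then be a common factor of the `q i`; so `0 < (π) < P` is a chain. -/
theorem two_le_height_of_forall_dvd_isUnit {B ι : Type*} [CommRing B] [IsDomain B]
    [UniqueFactorizationMonoid B] (P : Ideal B) [P.IsPrime] (q : ι → B) (hqP : ∀ i, q i ∈ P)
    (hq : ∀ g, (∀ i, g ∣ q i) → IsUnit g) : 2 ≤ P.height := by
  have hP : P ≠ ⊥ := by
    rintro rfl
    refine not_isUnit_zero (hq 0 fun i => ?_)
    rw [Ideal.mem_bot.1 (hqP i)]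
  obtain ⟨π, hπP, hπ⟩ := Ideal.IsPrime.exists_mem_prime_of_ne_bot ‹P.IsPrime› hP
  have hπi : (Ideal.span {π}).IsPrime := (Ideal.span_singleton_prime hπ.ne_zero).2 hπ
  have hlt : Ideal.span {π} < P := by
    refine lt_of_le_of_ne ((Ideal.span_singleton_le_iff_mem _).2 hπP) fun h => hπ.not_isUnit (hq π ?_)
    intro i
    rw [← Ideal.mem_span_singleton, h]
    exact hqP i
  have hlt' : (⊥ : Ideal B) < Ideal.span {π} := by
    rw [bot_lt_iff_ne_bot, Ne, Ideal.span_singleton_eq_bot]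
    exact hπ.ne_zero
  have h1 := Ideal.height_add_one_le_of_lt_of_isPrime hlt
  have h2 := Ideal.height_add_one_le_of_lt_of_isPrime hlt'
  calc (2 : ℕ∞) = 0 + 1 + 1 := by norm_num
    _ ≤ (⊥ : Ideal B).height + 1 + 1 := by gcongr; exact zero_le
    _ ≤ (Ideal.span {π}).height + 1 := by gcongr
    _ ≤ P.height := h1

theorem ringKrullDim_mvPolynomial_two : ringKrullDim (MvPolynomial (Fin 2) L) = 2 := by
  simp

theorem isMaximal_of_forall_dvd_isUnit {ι : Type*} (P : Ideal (MvPolynomial (Fin 2) L))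
    [P.IsPrime] (q : ι → MvPolynomial (Fin 2) L) (hqP : ∀ i, q i ∈ P)
    (hq : ∀ g, (∀ i, g ∣ q i) → IsUnit g) : P.IsMaximal := by
  obtain ⟨M, hM, hPM⟩ := Ideal.exists_le_maximal P ‹P.IsPrime›.ne_top
  obtain rfl | hlt := hPM.eq_or_lt
  · exact hM
  · have h1 := Ideal.height_add_one_le_of_lt_of_isPrime hlt
    have h2 := two_le_height_of_forall_dvd_isUnit P q hqP hq
    have h3 := Ideal.height_le_ringKrullDim_of_ne_top hM.ne_top
    rw [ringKrullDim_mvPolynomial_two] at h3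
    have h3' : M.height ≤ 2 := WithBot.coe_le_coe.1 h3
    have : (2 : ℕ∞) + 1 ≤ 2 := ((by gcongr : (2 : ℕ∞) + 1 ≤ P.height + 1).trans h1).trans h3'
    exact absurd this (by norm_num)

theorem height_idealOfVars_two : (idealOfVars (Fin 2) L).height = 2 := by
  refine le_antisymm ?_ (two_le_height_of_forall_dvd_isUnit _ (X : Fin 2 → MvPolynomial (Fin 2) L)
    (fun i => Ideal.subset_span ⟨i, rfl⟩) fun g hg => ?_)
  · have h3 := Ideal.height_le_ringKrullDim_of_ne_top
      (idealOfVars_isMaximal (L := L) (σ := Fin 2)).ne_top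
    rw [ringKrullDim_mvPolynomial_two] at h3
    exact WithBot.coe_le_coe.1 h3
  · by_contra hu
    have h0 := (X_prime (R := L) (i := (0 : Fin 2))).irreducible.dvd_iff.1 (hg 0)
    have h1 := (X_prime (R := L) (i := (1 : Fin 2))).irreducible.dvd_iff.1 (hg 1)
    have h01 := (h0.resolve_left hu).trans (h1.resolve_left hu).symm
    have := X_dvd_X.1 h01.dvd
    simp at this

variable (L) in
theorem ringKrullDim_localization_origin (R : Type*) [CommRing R]
    [Algebra (MvPolynomial (Fin 2) L) R] [IsLocalization.AtPrime R (idealOfVars (Fin 2) L)] :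
    ringKrullDim R = 2 := by
  rw [IsLocalization.AtPrime.ringKrullDim_eq_height (idealOfVars (Fin 2) L) R,
    height_idealOfVars_two]
  rfl

/-- A prime over the ideal contracts to a prime containing all `q i`; that prime is maximal for want
of a common factor, so it is the ideal of the origin. -/
theorem exists_maximalIdeal_pow_le {ι : Type*} (R : Type*) [CommRing R] [IsLocalRing R]
    [Algebra (MvPolynomial (Fin 2) L) R] [IsLocalization.AtPrime R (idealOfVars (Fin 2) L)]
    (q : ι → MvPolynomial (Fin 2) L) (hq : ∀ g, (∀ i, g ∣ q i) → IsUnit g) :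
    ∃ s, IsLocalRing.maximalIdeal R ^ s ≤
      Ideal.span (Set.range fun i => algebraMap (MvPolynomial (Fin 2) L) R (q i)) := by
  have : IsNoetherianRing R :=
    IsLocalization.isNoetherianRing (idealOfVars (Fin 2) L).primeCompl R inferInstance
  refine Ideal.exists_pow_le_of_le_radical_of_fg ?_ (IsNoetherian.noetherian _)
  rw [Ideal.radical_eq_sInf]
  refine le_sInf ?_
  rintro P ⟨hP, hPp⟩
  have hcomap : (P.under (MvPolynomial (Fin 2) L)).IsPrime := inferInstance
  have hmax := isMaximal_of_forall_dvd_isUnit (P.under (MvPolynomial (Fin 2) L)) q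
    (fun i => hP (Ideal.subset_span ⟨i, rfl⟩)) hq
  have hle : P ≤ IsLocalRing.maximalIdeal R := IsLocalRing.le_maximalIdeal hPp.ne_top
  have hle' : P.under (MvPolynomial (Fin 2) L) ≤ idealOfVars (Fin 2) L := by
    rw [← IsLocalization.AtPrime.under_maximalIdeal R (idealOfVars (Fin 2) L)]
    exact Ideal.comap_mono hle
  have heq := hmax.eq_of_le (idealOfVars_isMaximal (L := L)).ne_top hle'
  rw [← IsLocalization.AtPrime.map_eq_maximalIdeal (idealOfVars (Fin 2) L) R, ← heq]
  exact Ideal.map_comap_le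

end Origin

/-! ### Lengths, dimensions and a bound on independent forms -/

section Length

theorem length_eq_of_residue_surjective {k R M : Type*} [Field k] [CommRing R] [IsLocalRing R]
    [Algebra k R] [AddCommGroup M] [Module k M] [Module R M] [IsScalarTower k R M]
    (h : ∀ r : R, ∃ c : k, r - algebraMap k R c ∈ IsLocalRing.maximalIdeal R) :
    Module.length k M = Module.length R M := by
  have hloc : IsLocalHom (algebraMap k R) := inferInstance
  have hsurj : Function.Surjective
      (algebraMap (IsLocalRing.ResidueField k) (IsLocalRing.ResidueField R)) := by
    intro x
    obtain ⟨r, rfl⟩ := IsLocalRing.residue_surjective x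
    obtain ⟨c, hc⟩ := h r
    refine ⟨IsLocalRing.residue k c, ?_⟩
    rw [IsLocalRing.ResidueField.algebraMap_residue, eq_comm, ← sub_eq_zero, ← map_sub,
      IsLocalRing.residue_eq_zero_iff]
    exact hc
  rw [IsLocalRing.length_restrictScalars k R M, Module.length_eq_of_surjective hsurj,
    Module.length_eq_one (IsLocalRing.ResidueField R) (IsLocalRing.ResidueField R), mul_one]

variable {L R : Type*} [Field L] [CommRing R] [IsLocalRing R]
  [Algebra (MvPolynomial (Fin 2) L) R] [IsLocalization.AtPrime R (idealOfVars (Fin 2) L)]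

variable (L R) in
theorem exists_sub_algebraMap_mem_maximalIdeal_pow (t : ℕ) (r : R) :
    ∃ p : MvPolynomial (Fin 2) L, r - algebraMap _ R p ∈ IsLocalRing.maximalIdeal R ^ t := by
  obtain ⟨x, hx⟩ := (IsLocalization.AtPrime.equivQuotMaximalIdealPow (idealOfVars (Fin 2) L)
    R t).surjective (Ideal.Quotient.mk _ r)
  obtain ⟨p, rfl⟩ := Ideal.Quotient.mk_surjective x
  refine ⟨p, ?_⟩
  rw [IsLocalization.AtPrime.equivQuotMaximalIdealPow_apply_mk] at hx
  exact Ideal.Quotient.eq.1 hx.symm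

variable [Algebra L R] [IsScalarTower L (MvPolynomial (Fin 2) L) R]

variable (L R) in
theorem exists_sub_algebraMap_mem_maximalIdeal (r : R) :
    ∃ c : L, r - algebraMap L R c ∈ IsLocalRing.maximalIdeal R := by
  obtain ⟨p, hp⟩ := exists_sub_algebraMap_mem_maximalIdeal_pow L R 1 r
  rw [pow_one] at hp
  refine ⟨constantCoeff p, ?_⟩
  have : algebraMap (MvPolynomial (Fin 2) L) R (p - C (constantCoeff p)) ∈
      IsLocalRing.maximalIdeal R := by
    rw [← IsLocalization.AtPrime.map_eq_maximalIdeal (idealOfVars (Fin 2) L) R]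
    refine Ideal.mem_map_of_mem _ ?_
    rw [mem_idealOfVars_iff]
    simp
  have h := add_mem hp this
  rw [map_sub, sub_add_sub_cancel] at h
  rwa [IsScalarTower.algebraMap_apply L (MvPolynomial (Fin 2) L) R]

variable (L) in
-- The monomials of degree less than `t` suffice. The larger square of exponents gives the bound `t
-- * t`, crude but still quadratic.
theorem span_range_monomial_eq_top {M : Ideal R} {t : ℕ}
    (ht : IsLocalRing.maximalIdeal R ^ t ≤ M) :
    Submodule.span L (Set.range fun ab : Fin t × Fin t => (Ideal.Quotient.mk M
      (algebraMap (MvPolynomial (Fin 2) L) R (X 0 ^ (ab.1 : ℕ) * X 1 ^ (ab.2 : ℕ))))) = ⊤ := by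
  rw [eq_top_iff]
  rintro x -
  obtain ⟨r, rfl⟩ := Ideal.Quotient.mk_surjective x
  obtain ⟨p, hp⟩ := exists_sub_algebraMap_mem_maximalIdeal_pow L R t r
  rw [Ideal.Quotient.eq.2 (ht hp)]
  rw [← support_sum_monomial_coeff p, map_sum, map_sum]
  refine Submodule.sum_mem _ fun m _ => ?_
  have hsplit : monomial m (coeff m p) = coeff m p • (monomial m (1 : L)) := by
    rw [smul_monomial, smul_eq_mul, mul_one]
  have hsmul : Ideal.Quotient.mk M (algebraMap (MvPolynomial (Fin 2) L) R
      (monomial m (coeff m p))) = coeff m p • Ideal.Quotient.mk M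
        (algebraMap (MvPolynomial (Fin 2) L) R (monomial m 1)) := by
    rw [hsplit, algebraMap.smul]
    rfl
  rw [hsmul]
  refine Submodule.smul_mem _ _ ?_
  by_cases hm : t ≤ m.degree
  · have : algebraMap (MvPolynomial (Fin 2) L) R (monomial m 1) ∈ M := by
      refine ht ?_
      rw [← IsLocalization.AtPrime.map_eq_maximalIdeal (idealOfVars (Fin 2) L) R, ← Ideal.map_pow]
      exact Ideal.mem_map_of_mem _ ((monomial_mem_pow_idealOfVars_iff _ _ one_ne_zero).2 hm)
    rw [Ideal.Quotient.eq_zero_iff_mem.2 this]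
    exact zero_mem _
  · refine Submodule.subset_span ⟨(⟨m 0, ?_⟩, ⟨m 1, ?_⟩), ?_⟩
    · exact (Finsupp.le_degree 0 m).trans_lt (not_le.1 hm)
    · exact (Finsupp.le_degree 1 m).trans_lt (not_le.1 hm)
    · rw [monomial_eq, C_1, one_mul, Finsupp.prod_fintype _ _ (fun _ => pow_zero _),
        Fin.prod_univ_two]

theorem finite_quotient_of_maximalIdeal_pow_le {M : Ideal R} {t : ℕ}
    (ht : IsLocalRing.maximalIdeal R ^ t ≤ M) : Module.Finite L (R ⧸ M) :=
  ⟨span_range_monomial_eq_top L ht ▸ Submodule.fg_span (Set.finite_range _)⟩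

theorem finrank_quotient_le_of_maximalIdeal_pow_le {M : Ideal R} {t : ℕ}
    (ht : IsLocalRing.maximalIdeal R ^ t ≤ M) : Module.finrank L (R ⧸ M) ≤ t * t := by
  have := finrank_range_le_card (R := L) fun ab : Fin t × Fin t => (Ideal.Quotient.mk M
      (algebraMap (MvPolynomial (Fin 2) L) R (X 0 ^ (ab.1 : ℕ) * X 1 ^ (ab.2 : ℕ))))
  rw [Set.finrank, span_range_monomial_eq_top L ht, finrank_top] at this
  simpa using this

variable (L) in
theorem length_quotient_eq_finrank {M : Ideal R} {t : ℕ}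
    (ht : IsLocalRing.maximalIdeal R ^ t ≤ M) :
    Module.length R (R ⧸ M) = Module.finrank L (R ⧸ M) := by
  have := finite_quotient_of_maximalIdeal_pow_le (L := L) ht
  rw [← Module.length_eq_finrank, length_eq_of_residue_surjective
    (exists_sub_algebraMap_mem_maximalIdeal L R)]

/-- By induction on `n`, the components below degree `n` vanish, and those above have values in `I ^
(n + 1)`; so the value of the component of degree `n` lies there too. -/
theorem homogeneousComponent_eq_zero_of_aeval_mem_pow {σ L R : Type*} [Field L] [CommRing R]
    [Algebra L R] {I : Ideal R} {h : σ → R} (hI : ∀ i, h i ∈ I)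
    (hinj : ∀ n (g : MvPolynomial σ L), g.IsHomogeneous n → aeval h g ∈ I ^ (n + 1) → g = 0)
    {G : MvPolynomial σ L} {N : ℕ} (hG : aeval h G ∈ I ^ N) {n : ℕ} (hn : n < N) :
    homogeneousComponent n G = 0 := by
  induction n using Nat.strong_induction_on with
  | _ n ih =>
    by_cases hD : n ∈ Finset.range (G.totalDegree + 1)
    · refine hinj n _ (homogeneousComponent_isHomogeneous n G) ?_
      have hsum : aeval h (homogeneousComponent n G) = aeval h G -
          ∑ i ∈ (Finset.range (G.totalDegree + 1)).erase n, aeval h (homogeneousComponent i G) := by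
        rw [eq_sub_iff_add_eq, Finset.add_sum_erase _
          (fun i => aeval h (homogeneousComponent i G)) hD, ← map_sum, sum_homogeneousComponent]
      rw [hsum]
      refine sub_mem (Ideal.pow_le_pow_right hn hG) (sum_mem fun i hi => ?_)
      obtain hlt | hgt := lt_or_gt_of_ne (Finset.ne_of_mem_erase hi)
      · rw [ih i hlt (hlt.trans hn), map_zero]
        exact zero_mem _
      · exact Ideal.pow_le_pow_right hgt
          (aeval_mem_pow_of_isHomogeneous h hI (homogeneousComponent_isHomogeneous i G))
    · exact homogeneousComponent_eq_zero _ _ (by simpa using hD)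

/-- In a two-dimensional regular local ring, the forms in three elements of an ideal `I` that is
primary for the maximal ideal cannot be independent modulo the next power of `I`. -/
theorem false_of_independent_forms {I : Ideal R} {s : ℕ}
    (hs : IsLocalRing.maximalIdeal R ^ s ≤ I) {h : Fin 3 → R} (hI : ∀ i, h i ∈ I)
    (hinj : ∀ n (g : MvPolynomial (Fin 3) L), g.IsHomogeneous n → aeval h g ∈ I ^ (n + 1) →
      g = 0) : False := by
  -- The `M ^ 3` monomials with exponents below `M` have degree below `3 * M` and stay independent
  -- in `R / I ^ (3 * M)`. That space has dimension at most `(3 * s * M) ^ 2 = 9 * s ^ 2 * M ^ 2`,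
  -- which this `M` makes smaller than `M ^ 3`.
  set M := 9 * (s * s) + 1 with hM
  let f : MvPolynomial (Fin 3) L →ₗ[L] (R ⧸ I ^ (3 * M)) :=
    ((Ideal.Quotient.mkₐ L (I ^ (3 * M))).comp (aeval h)).toLinearMap
  let v : (Fin 3 → Fin M) → MvPolynomial (Fin 3) L :=
    fun α => basisMonomials (Fin 3) L (Finsupp.equivFunOnFinite.symm fun i => (α i : ℕ))
  have hv : LinearIndependent L v := by
    refine (basisMonomials (Fin 3) L).linearIndependent.comp _ ?_
    intro α β hαβ
    funext i
    exact Fin.ext (congrFun (Finsupp.equivFunOnFinite.symm.injective hαβ) i)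
  have hsub : Submodule.span L (Set.range v) ≤ restrictTotalDegree (Fin 3) L (3 * M - 1) := by
    rw [Submodule.span_le]
    rintro _ ⟨α, rfl⟩
    rw [SetLike.mem_coe, mem_restrictTotalDegree]
    simp only [v, coe_basisMonomials]
    refine (totalDegree_monomial_le _ _).trans ?_
    rw [Finsupp.sum_fintype _ _ (fun _ => rfl), Fin.sum_univ_three]
    simp only [Finsupp.equivFunOnFinite_symm_apply_apply, id_eq]
    have := (α 0).2
    have := (α 1).2
    have := (α 2).2
    omega
  have hdisj : Disjoint (Submodule.span L (Set.range v)) (LinearMap.ker f) := by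
    rw [Submodule.disjoint_def]
    intro G hGv hGf
    have hdeg := hsub hGv
    rw [mem_restrictTotalDegree] at hdeg
    have hG : aeval h G ∈ I ^ (3 * M) := Ideal.Quotient.eq_zero_iff_mem.1 hGf
    rw [← sum_homogeneousComponent G]
    refine Finset.sum_eq_zero fun i hi => ?_
    exact homogeneousComponent_eq_zero_of_aeval_mem_pow hI hinj hG
      (by have := Finset.mem_range.1 hi; omega)
  have hle : IsLocalRing.maximalIdeal R ^ (s * (3 * M)) ≤ I ^ (3 * M) := by
    rw [pow_mul]
    exact Ideal.pow_right_mono hs _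
  have := finite_quotient_of_maximalIdeal_pow_le (L := L) hle
  have h1 := (hv.map hdisj).fintype_card_le_finrank.trans
    (finrank_quotient_le_of_maximalIdeal_pow_le (L := L) hle)
  simp only [Fintype.card_fun, Fintype.card_fin] at h1
  have h2 : M ^ 3 = (s * (3 * M)) * (s * (3 * M)) + M ^ 2 := by
    rw [hM]
    ring
  have h3 : 0 < M ^ 2 := by positivity
  omega

end Length

/-! ### Extension of the ground field -/

section BaseChange

variable {K F R S : Type*} [Field K] [Field F] [Algebra K F]
  [CommRing R] [Algebra (MvPolynomial (Fin 2) K) R]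
  [IsLocalization.AtPrime R (idealOfVars (Fin 2) K)]
  [CommRing S] [Algebra (MvPolynomial (Fin 2) F) S]
  [IsLocalization.AtPrime S (idealOfVars (Fin 2) F)]

variable (K F R S) in
/-- The extension of scalars from `K` to `F` between the local rings of the plane at the origin. -/
def extendScalars : R →+* S :=
  IsLocalization.map (M := (idealOfVars (Fin 2) K).primeCompl)
    (T := (idealOfVars (Fin 2) F).primeCompl) S
    (map (σ := Fin 2) (algebraMap K F)) (by
      intro f hf
      rw [Submonoid.mem_comap, Ideal.mem_primeCompl_iff, mem_idealOfVars_iff, constantCoeff_map,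
        map_eq_zero, ← mem_idealOfVars_iff]
      exact hf)

theorem extendScalars_algebraMap (f : MvPolynomial (Fin 2) K) :
    extendScalars K F R S (algebraMap _ R f) =
      algebraMap (MvPolynomial (Fin 2) F) S (map (algebraMap K F) f) :=
  IsLocalization.map_eq _ _

theorem map_extendScalars_span {ι : Type*} (q : ι → MvPolynomial (Fin 2) K) :
    (Ideal.span (Set.range fun i => algebraMap _ R (q i))).map (extendScalars K F R S) =
      Ideal.span (Set.range fun i =>
        algebraMap (MvPolynomial (Fin 2) F) S (map (algebraMap K F) (q i))) := by
  rw [Ideal.map_span, ← Set.range_comp]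
  congr 2
  funext i
  exact extendScalars_algebraMap _

variable [IsLocalRing R] [IsLocalRing S]

theorem map_extendScalars_maximalIdeal :
    (IsLocalRing.maximalIdeal R).map (extendScalars K F R S) = IsLocalRing.maximalIdeal S := by
  have h := map_extendScalars_span (F := F) (R := R) (S := S)
    (X : Fin 2 → MvPolynomial (Fin 2) K)
  simp only [map_X] at h
  rw [← IsLocalization.AtPrime.map_eq_maximalIdeal (idealOfVars (Fin 2) K) R,
    ← IsLocalization.AtPrime.map_eq_maximalIdeal (idealOfVars (Fin 2) F) S, idealOfVars,
    idealOfVars, Ideal.map_span (algebraMap _ R), Ideal.map_span (algebraMap _ S),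
    ← Set.range_comp, ← Set.range_comp]
  exact h

/-- Under a flat local homomorphism lengths are multiplied by the length of the closed fibre, which
is here the residue field of `S`. -/
theorem length_quotient_map_extendScalars (I : Ideal R) :
    Module.length S (S ⧸ I.map (extendScalars K F R S)) = Module.length R (R ⧸ I) := by
  let _ := (extendScalars K F R S).toAlgebra
  let _ : Algebra (MvPolynomial (Fin 2) K) (MvPolynomial (Fin 2) F) := algebraMvPolynomial
  let _ : Algebra (MvPolynomial (Fin 2) K) S :=
    ((algebraMap (MvPolynomial (Fin 2) F) S).comp (map (algebraMap K F))).toAlgebra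
  have : IsScalarTower (MvPolynomial (Fin 2) K) (MvPolynomial (Fin 2) F) S :=
    IsScalarTower.of_algebraMap_eq fun _ => rfl
  have : IsScalarTower (MvPolynomial (Fin 2) K) R S :=
    IsScalarTower.of_algebraMap_eq fun f => (extendScalars_algebraMap f).symm
  have : Module.Flat (MvPolynomial (Fin 2) K) (MvPolynomial (Fin 2) F) :=
    Module.Flat.isBaseChange K (MvPolynomial (Fin 2) K) F (MvPolynomial (Fin 2) F)
      (Algebra.IsPushout.out (R := K) (S := MvPolynomial (Fin 2) K) (R' := F)
        (S' := MvPolynomial (Fin 2) F))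
  have : Module.Flat (MvPolynomial (Fin 2) F) S :=
    IsLocalization.flat S (idealOfVars (Fin 2) F).primeCompl
  have : Module.Flat R S :=
    (Module.flat_iff_of_isLocalization R (idealOfVars (Fin 2) K).primeCompl S).2
      (Module.Flat.trans (MvPolynomial (Fin 2) K) (MvPolynomial (Fin 2) F) S)
  have : IsLocalHom (algebraMap R S) :=
    ((IsLocalRing.local_hom_TFAE (algebraMap R S)).out 0 2).2 map_extendScalars_maximalIdeal.le
  have h := IsLocalRing.length_baseChange R S (R ⧸ I)
  change Module.length S (S ⧸ I.map (algebraMap R S)) = _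
  rw [(Algebra.TensorProduct.quotIdealMapEquivTensorQuot S I).toLinearEquiv.length_eq, h]
  have hm : (IsLocalRing.maximalIdeal R).map (algebraMap R S) = IsLocalRing.maximalIdeal S :=
    map_extendScalars_maximalIdeal
  have hs : IsSimpleModule S (S ⧸ IsLocalRing.maximalIdeal S) :=
    isSimpleModule_iff_isCoatom.2 (IsLocalRing.maximalIdeal.isMaximal S).out
  rw [hm, Module.length_eq_one S (S ⧸ IsLocalRing.maximalIdeal S), mul_one]

end BaseChange

/-! ### Regular sequences -/

section Regular

/-- Two elements that generate an ideal primary for the maximal ideal of the local ring of the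
plane at the origin form a regular sequence. -/
theorem exists_eq_mul_of_mul_add_mul_eq_zero (L : Type*) {S : Type*} [Field L] [CommRing S]
    [IsLocalRing S] [Algebra (MvPolynomial (Fin 2) L) S]
    [IsLocalization.AtPrime S (idealOfVars (Fin 2) L)] {a b : S} {t : ℕ}
    (ha : a ∈ IsLocalRing.maximalIdeal S) (hb : b ∈ IsLocalRing.maximalIdeal S)
    (ht : IsLocalRing.maximalIdeal S ^ t ≤ Ideal.span {a, b}) :
    (∀ z, z * a = 0 → z = 0) ∧
      ∀ x y, x * a + y * b = 0 → ∃ z, x = z * b ∧ y = -(z * a) := by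
  have : IsDomain S := IsLocalization.isDomain_of_le_nonZeroDivisors (M :=
    (idealOfVars (Fin 2) L).primeCompl) _ (Ideal.primeCompl_le_nonZeroDivisors _)
  have : UniqueFactorizationMonoid S :=
    UniqueFactorizationMonoid.of_isLocalization (idealOfVars (Fin 2) L).primeCompl S
  have : IsNoetherianRing S :=
    IsLocalization.isNoetherianRing (idealOfVars (Fin 2) L).primeCompl S inferInstance
  -- A minimal prime over a common nonunit factor has height at most one by Krull's theorem, yet it
  -- contains a power of the maximal ideal, whose height is two.
  have hrel : IsRelPrime a b := by
    intro d hda hdb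
    by_contra hd
    have hne : Ideal.span {d} ≠ ⊤ := by rwa [Ne, Ideal.span_singleton_eq_top]
    obtain ⟨P, hP, -⟩ := Ideal.exists_minimalPrimes_le (J := IsLocalRing.maximalIdeal S)
      (IsLocalRing.le_maximalIdeal hne)
    have hprime : P.IsPrime := hP.1.1
    have hle : IsLocalRing.maximalIdeal S ^ t ≤ P := by
      refine ht.trans (le_trans ?_ hP.1.2)
      rw [Ideal.span_le]
      rintro z (rfl | rfl)
      · exact Ideal.mem_span_singleton.2 hda
      · exact Ideal.mem_span_singleton.2 hdb
    have heq : IsLocalRing.maximalIdeal S = P :=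
      le_antisymm (hprime.le_of_pow_le hle) (IsLocalRing.le_maximalIdeal hprime.ne_top)
    have h1 := Ideal.height_le_one_of_isPrincipal_of_mem_minimalPrimes _ P hP
    have h2 := IsLocalRing.maximalIdeal_height_eq_ringKrullDim (R := S)
    rw [ringKrullDim_localization_origin L S, heq] at h2
    have h3 : P.height = 2 := WithBot.coe_injective h2
    rw [h3] at h1
    exact absurd h1 (by norm_num)
  have ha0 : a ≠ 0 := by
    rintro rfl
    exact hb (isRelPrime_zero_left.1 hrel)
  have hb0 : b ≠ 0 := by
    rintro rfl
    exact ha (isRelPrime_zero_right.1 hrel)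
  refine ⟨fun z hz => (mul_eq_zero.1 hz).resolve_right ha0, fun x y hxy => ?_⟩
  have hdvd : b ∣ x * a := ⟨-y, by linear_combination hxy⟩
  obtain ⟨z, rfl⟩ := hrel.symm.dvd_of_dvd_mul_right hdvd
  refine ⟨z, mul_comm _ _, ?_⟩
  have : b * (z * a + y) = 0 := by linear_combination hxy
  linear_combination (mul_eq_zero.1 this).resolve_left hb0

end Regular

/-! ### Dehomogenization of ternary forms -/

section Dehomogenization

variable {L : Type*} [Field L]

/-- The dehomogenization of a ternary form with respect to the `j`-th coordinate, translated by
`a`. -/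
def dehomogenize (j : Fin 3) (a : Fin 2 → L) :
    MvPolynomial (Fin 3) L →ₐ[L] MvPolynomial (Fin 2) L :=
  aeval (Fin.insertNth (α := fun _ => MvPolynomial (Fin 2) L) j 1 fun k => X k + C (a k))

@[simp]
theorem dehomogenize_X_self (j : Fin 3) (a : Fin 2 → L) : dehomogenize j a (X j) = 1 := by
  simp [dehomogenize]

@[simp]
theorem dehomogenize_X_succAbove (j : Fin 3) (a : Fin 2 → L) (k : Fin 2) :
    dehomogenize j a (X (j.succAbove k)) = X k + C (a k) := by
  simp [dehomogenize]

/-- Evaluating a dehomogenization at `t_i / t_j - a_i` gives the value of the form at the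
quotients `t_i / t_j`. -/
theorem aeval_dehomogenize {E : Type*} [CommRing E] [Algebra L E] (j : Fin 3) (a : Fin 2 → L)
    (v : Fin 3 → E) (hv : v j = 1) (f : MvPolynomial (Fin 3) L) :
    aeval (fun k => v (j.succAbove k) - algebraMap L E (a k)) (dehomogenize j a f) =
      aeval v f := by
  rw [← AlgHom.comp_apply]
  congr 1
  refine MvPolynomial.algHom_ext fun i => ?_
  obtain rfl | ⟨k, rfl⟩ := j.eq_self_or_eq_succAbove i
  · simp [hv]
  · simp

/-- Evaluation at the quotients `t_i / t_j` in the fraction field recovers `f / t_j ^ n` from the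
dehomogenization. -/
theorem eq_zero_of_dehomogenize_eq_zero {j : Fin 3} {a : Fin 2 → L}
    {f : MvPolynomial (Fin 3) L} {n : ℕ} (hf : f.IsHomogeneous n)
    (h : dehomogenize j a f = 0) : f = 0 := by
  let E := FractionRing (MvPolynomial (Fin 3) L)
  let τ : Fin 3 → E := fun i => algebraMap (MvPolynomial (Fin 3) L) E (X i)
  have hτ : τ j ≠ 0 := by
    simp only [τ]
    rw [Ne, FaithfulSMul.algebraMap_eq_zero_iff]
    exact X_ne_zero j
  have h1 := aeval_dehomogenize j a (fun i => τ i * (τ j)⁻¹) (mul_inv_cancel₀ hτ) f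
  rw [h, map_zero, aeval_mul_of_isHomogeneous hf] at h1
  have h2 := (mul_eq_zero.1 h1.symm).resolve_right (pow_ne_zero _ (inv_ne_zero hτ))
  have h3 : aeval τ f = algebraMap _ E f := by
    simp only [τ]
    rw [show (fun i => algebraMap (MvPolynomial (Fin 3) L) E (X i)) =
      algebraMap (MvPolynomial (Fin 3) L) E ∘ X from rfl, aeval_algebraMap_apply, aeval_X_left_apply]
  rw [h3, FaithfulSMul.algebraMap_eq_zero_iff] at h2
  exact h2

theorem eq_zero_of_aeval_eq_zero_of_algebraicIndependent {E : Type*} [CommRing E] [Algebra L E]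
    {v : Fin 3 → E} (hv : v 0 = 1) (hind : AlgebraicIndependent L fun k : Fin 2 => v k.succ)
    {g : MvPolynomial (Fin 3) L} {n : ℕ} (hg : g.IsHomogeneous n) (h : aeval v g = 0) : g = 0 := by
  have h1 := aeval_dehomogenize 0 (0 : Fin 2 → L) v hv g
  rw [h] at h1
  simp only [Pi.zero_apply, map_zero, sub_zero, Fin.succAbove_zero] at h1
  exact eq_zero_of_dehomogenize_eq_zero hg
    ((injective_iff_map_eq_zero _).1 hind _ h1)

end Dehomogenization

/-! ### The reduction and the multiplicity formula in the local ring -/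

section LocalTheorem

theorem algebraicIndependent_fin_two {K F : Type*} [Field K] [Field F] [Algebra K F] {u v : F}
    (hu : Transcendental K u) (hv : Transcendental (Algebra.adjoin K {u}) v) :
    AlgebraicIndependent K ![u, v] := by
  have h1 : AlgebraicIndependent K (fun _ : Unit => u) :=
    algebraicIndependent_unique_type_iff.2 hu
  have h2 := (h1.option_iff_transcendental v).2 (by rwa [Set.range_const])
  have h3 := h2.comp ![some (), none] (by
    intro i j hij
    fin_cases i <;> fin_cases j <;> simp_all)
  convert h3 using 1
  funext i
  fin_cases i <;> rfl

variable {K F R S : Type*} [Field K] [Field F] [Algebra K F]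
  [CommRing R] [Algebra K R] [Algebra (MvPolynomial (Fin 2) K) R]
  [IsScalarTower K (MvPolynomial (Fin 2) K) R]
  [IsLocalization.AtPrime R (idealOfVars (Fin 2) K)]
  [CommRing S] [Algebra F S] [Algebra (MvPolynomial (Fin 2) F) S]
  [IsScalarTower F (MvPolynomial (Fin 2) F) S]
  [IsLocalization.AtPrime S (idealOfVars (Fin 2) F)]

theorem aeval_map_eq_extendScalars (r : Fin 4 → R) (g : MvPolynomial (Fin 4) K) :
    aeval (fun i => extendScalars K F R S (r i)) (map (algebraMap K F) g) =
      extendScalars K F R S (aeval r g) := by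
  have hc (c : K) : algebraMap F S (algebraMap K F c) =
      extendScalars K F R S (algebraMap K R c) := by
    rw [IsScalarTower.algebraMap_apply K (MvPolynomial (Fin 2) K) R,
      IsScalarTower.algebraMap_apply F (MvPolynomial (Fin 2) F) S, extendScalars_algebraMap,
      algebraMap_eq, algebraMap_eq, map_C]
  induction g using MvPolynomial.induction_on with
  | C c => rw [map_C, aeval_C, aeval_C, hc]
  | add p q hp hq => simp only [map_add, hp, hq]
  | mul_X p i hp => simp only [map_mul, hp, map_X, aeval_X]

variable [IsLocalRing R] [IsLocalRing S]

/-- Two generic combinations of the generators of an ideal `I` that is primary for the maximal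
ideal of the local ring of the plane at the origin generate a reduction of `I`. -/
theorem exists_pow_succ_eq_of_generic [IsAlgClosed F] {x : Fin 4 ⊕ Fin 4 → F}
    (hx : AlgebraicIndependent K x) {r : Fin 4 → R}
    (hr : ∀ i, r i ∈ IsLocalRing.maximalIdeal R) {s : ℕ}
    (hs : IsLocalRing.maximalIdeal R ^ s ≤ Ideal.span (Set.range r)) {a b : S}
    (ha : a = ∑ i, algebraMap F S (x (Sum.inl i)) * extendScalars K F R S (r i))
    (hb : b = ∑ i, algebraMap F S (x (Sum.inr i)) * extendScalars K F R S (r i)) :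
    ∃ c, (Ideal.span (Set.range r)).map (extendScalars K F R S) ^ (c + 1) =
      Ideal.span {a, b} * (Ideal.span (Set.range r)).map (extendScalars K F R S) ^ c := by
  set I := Ideal.span (Set.range r) with hI
  set q : Fin 4 → S := fun i => extendScalars K F R S (r i) with hq
  have hIS : I.map (extendScalars K F R S) = Ideal.span (Set.range q) := by
    rw [hI, Ideal.map_span, ← Set.range_comp]
    rfl
  have : IsNoetherianRing S :=
    IsLocalization.isNoetherianRing (idealOfVars (Fin 2) F).primeCompl S inferInstance
  have hrI (i : Fin 4) : r i ∈ I := Ideal.subset_span ⟨i, rfl⟩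
  let lin (y : Fin 4 → F) : MvPolynomial (Fin 4) F := ∑ i, C (y i) * X i
  have hlin (y : Fin 4 → F) : (lin y).IsHomogeneous 1 :=
    IsHomogeneous.sum _ _ _ fun i _ => isHomogeneous_C_mul_X _ _
  have hlinq (y : Fin 4 → F) : aeval q (lin y) = ∑ i, algebraMap F S (y i) * q i := by
    simp [lin]
  have hlinc (y c : Fin 4 → F) : eval c (lin y) = ∑ i, y i * c i := by
    simp [lin]
  -- The initial relations over `K` among the generators, together with the two generic linear
  -- forms.
  let G : Set (MvPolynomial (Fin 4) F) :=
    {f | ∃ (d : ℕ) (g : MvPolynomial (Fin 4) K), g.IsHomogeneous d ∧ aeval r g ∈ I ^ (d + 1) ∧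
      f = map (algebraMap K F) g} ∪
      {lin fun i => x (Sum.inl i), lin fun i => x (Sum.inr i)}
  obtain ⟨c, hc⟩ := exists_pow_succ_le_of_forall_eval_eq_zero q (Ideal.span {a, b}) G (by
    rintro f (⟨d, g, hg, hgI, rfl⟩ | rfl | rfl)
    · refine ⟨d, hg.map _, Ideal.mem_sup_left ?_⟩
      rw [hq, aeval_map_eq_extendScalars, ← hIS, ← Ideal.map_pow]
      exact Ideal.mem_map_of_mem _ hgI
    · refine ⟨1, hlin _, Ideal.mem_sup_right ?_⟩
      rw [Nat.sub_self, pow_zero, mul_one, hlinq, ← ha]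
      exact Ideal.subset_span (by simp)
    · refine ⟨1, hlin _, Ideal.mem_sup_right ?_⟩
      rw [Nat.sub_self, pow_zero, mul_one, hlinq, ← hb]
      exact Ideal.subset_span (by simp)) (by
    intro c hc
    by_contra hne
    obtain ⟨j, hj⟩ : ∃ j, c j ≠ 0 := by
      by_contra h
      push Not at h
      exact hne (funext h)
    refine false_of_generic_incidence hx hj ?_ ?_ ?_
    · intro k l hk
      by_contra hl
      -- Two independent ratios make `(c j : c k : c l)` a generic point of the plane over `K`.
      -- Every initial relation among `r j`, `r k`, `r l` vanishes there, hence is zero, against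
      -- `false_of_independent_forms`.
      have hind := algebraicIndependent_fin_two hk hl
      let e : Fin 3 → Fin 4 := ![j, k, l]
      refine false_of_independent_forms (L := K) hs (h := fun i => r (e i)) (fun i => hrI _) ?_
      intro n g hg hgI
      refine eq_zero_of_aeval_eq_zero_of_algebraicIndependent (E := F)
        (v := fun i => c (e i) * (c j)⁻¹) (mul_inv_cancel₀ hj) ?_ hg ?_
      · convert hind using 1
        funext i
        fin_cases i <;> simp [e, div_eq_mul_inv]
      · rw [aeval_mul_of_isHomogeneous hg]
        have h0 := hc (map (algebraMap K F) (rename e g)) (Or.inl ⟨n, rename e g,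
          hg.rename_isHomogeneous, by rw [aeval_rename]; exact hgI, rfl⟩)
        rw [eval_map, ← aeval_def, aeval_rename] at h0
        have h0' : aeval (fun i => c (e i)) g = 0 := h0
        rw [h0', zero_mul]
    · rw [← hlinc (fun i => x (Sum.inl i))]
      exact hc _ (Or.inr (Or.inl rfl))
    · rw [← hlinc (fun i => x (Sum.inr i))]
      exact hc _ (Or.inr (Or.inr rfl)))
  refine ⟨c, ?_⟩
  rw [hIS]
  have hqm : Ideal.span (Set.range q) ≤ IsLocalRing.maximalIdeal S := by
    rw [← hIS, ← map_extendScalars_maximalIdeal (K := K) (F := F) (R := R)]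
    refine Ideal.map_mono (Ideal.span_le.2 ?_)
    rintro _ ⟨i, rfl⟩
    exact hr i
  refine le_antisymm ?_ ?_
  · refine Submodule.le_of_le_smul_of_le_jacobson_bot (I := Ideal.span (Set.range q))
      (IsNoetherian.noetherian _) ?_ ?_
    · rw [IsLocalRing.jacobson_eq_maximalIdeal _ bot_ne_top]
      exact hqm
    · rw [smul_eq_mul, ← pow_succ', sup_comm]
      exact hc
  · rw [pow_succ']
    refine Ideal.mul_mono_left (Ideal.span_le.2 ?_)
    rintro z (rfl | rfl)
    · rw [ha]
      exact Ideal.sum_mem _ fun i _ => Ideal.mul_mem_left _ _ (Ideal.subset_span ⟨i, rfl⟩)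
    · rw [hb]
      exact Ideal.sum_mem _ fun i _ => Ideal.mul_mem_left _ _ (Ideal.subset_span ⟨i, rfl⟩)

/-- The Hilbert–Samuel multiplicity of an ideal generated by four elements in the local ring of the
plane at the origin is the colength of two generic combinations of the generators. -/
theorem exists_hasHilbertSamuelMultiplicity_of_generic [IsAlgClosed F] {x : Fin 4 ⊕ Fin 4 → F}
    (hx : AlgebraicIndependent K x) {r : Fin 4 → R}
    (hr : ∀ i, r i ∈ IsLocalRing.maximalIdeal R) {s : ℕ}
    (hs : IsLocalRing.maximalIdeal R ^ s ≤ Ideal.span (Set.range r)) {a b : S}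
    (ha : a = ∑ i, algebraMap F S (x (Sum.inl i)) * extendScalars K F R S (r i))
    (hb : b = ∑ i, algebraMap F S (x (Sum.inr i)) * extendScalars K F R S (r i)) :
    ∃ e : ℕ, HasHilbertSamuelMultiplicity (Ideal.span (Set.range r)) e ∧
      Module.rank F (S ⧸ Ideal.span {a, b}) = e := by
  obtain ⟨c, hc⟩ := exists_pow_succ_eq_of_generic hx hr hs ha hb
  set I := Ideal.span (Set.range r) with hI
  set IS := I.map (extendScalars K F R S) with hIS
  have : IsNoetherianRing S :=
    IsLocalization.isNoetherianRing (idealOfVars (Fin 2) F).primeCompl S inferInstance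
  have hrI (i : Fin 4) : extendScalars K F R S (r i) ∈ IS :=
    Ideal.mem_map_of_mem _ (Ideal.subset_span ⟨i, rfl⟩)
  have haI : a ∈ IS := ha ▸ Ideal.sum_mem _ fun i _ => Ideal.mul_mem_left _ _ (hrI i)
  have hbI : b ∈ IS := hb ▸ Ideal.sum_mem _ fun i _ => Ideal.mul_mem_left _ _ (hrI i)
  have hISm : IS ≤ IsLocalRing.maximalIdeal S := by
    rw [← map_extendScalars_maximalIdeal (K := K) (F := F) (R := R)]
    refine Ideal.map_mono (Ideal.span_le.2 ?_)
    rintro _ ⟨i, rfl⟩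
    exact hr i
  have hsS : IsLocalRing.maximalIdeal S ^ s ≤ IS := by
    rw [← map_extendScalars_maximalIdeal (K := K) (F := F) (R := R), ← Ideal.map_pow]
    exact Ideal.map_mono hs
  have hJ : IsLocalRing.maximalIdeal S ^ (s * (c + 1)) ≤ Ideal.span {a, b} := by
    rw [pow_mul]
    refine (Ideal.pow_right_mono hsS _).trans ?_
    rw [hc]
    exact Ideal.mul_le_left
  have hpow (n : ℕ) : IsLocalRing.maximalIdeal R ^ (s * n) ≤ I ^ n := by
    rw [pow_mul]
    exact Ideal.pow_right_mono hs _
  obtain ⟨hreg1, hreg2⟩ := exists_eq_mul_of_mul_add_mul_eq_zero F (hISm haI) (hISm hbI) hJ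
  obtain ⟨N, hN⟩ := exists_forall_mem_pow_of_mul_mem_pow_succ hreg1 hc
  have hlenJ := length_quotient_eq_finrank F hJ
  have hfinJ := finite_quotient_of_maximalIdeal_pow_le (L := F) hJ
  have hlen (n : ℕ) := length_quotient_eq_finrank K (hpow n)
  -- The recursion is proved over `S`, where the generic combinations live; its lengths are those
  -- over `R`.
  have hlenS (n : ℕ) : Module.length S (S ⧸ IS ^ n) = Module.finrank K (R ⧸ I ^ n) := by
    rw [← hlen n, ← length_quotient_map_extendScalars (K := K) (F := F) (R := R) (S := S),
      Ideal.map_pow]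
  refine ⟨Module.finrank F (S ⧸ Ideal.span {a, b}), ?_, (Module.finrank_eq_rank _ _).symm⟩
  refine hasHilbertSamuelMultiplicity_of_second_difference (N := N + c)
    (ringKrullDim_localization_origin K R) (fun n => Module.finrank K (R ⧸ I ^ n)) hlen ?_
  intro n hn
  have hred : IS ^ (n + 2) = Ideal.span {a, b} * IS ^ (n + 1) := by
    obtain ⟨k, hk⟩ := Nat.exists_eq_add_of_le (show c ≤ n + 1 by omega)
    rw [hk, show n + 2 = (c + 1) + k by omega, pow_add, hc, mul_assoc, ← pow_add]
  have h := length_quotient_pow_add hreg2 haI hbI hred (hN n (by omega))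
  rw [hlenS, hlenS, hlenS, hlenJ] at h
  exact_mod_cast h

end LocalTheorem

/-! ### Affine charts of the projective plane -/

section Chart

variable {k : Type u} [Field k]

/-- The point of affine 3-space with `j`-th coordinate `1` and other coordinates `a`. -/
def chartVector (j : Fin 3) (a : Fin 2 → k) : Fin 3 → k :=
  Fin.insertNth (α := fun _ => k) j 1 a

@[simp]
theorem chartVector_self (j : Fin 3) (a : Fin 2 → k) : chartVector j a j = 1 := by
  simp [chartVector]

@[simp]
theorem chartVector_succAbove (j : Fin 3) (a : Fin 2 → k) (i : Fin 2) :
    chartVector j a (j.succAbove i) = a i := by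
  simp [chartVector]

theorem chartVector_ne_zero (j : Fin 3) (a : Fin 2 → k) : chartVector j a ≠ 0 := fun h => by
  have := congrFun h j
  simp at this

/-- The point `A` has affine coordinates `a` in the `j`-th chart. -/
def HasAffineCoordinates (A : Plane k) (j : Fin 3) (a : Fin 2 → k) : Prop :=
  ∃ c : k, c ≠ 0 ∧ A.rep = c • chartVector j a

theorem exists_hasAffineCoordinates (A : Plane k) : ∃ j a, HasAffineCoordinates A j a := by
  obtain ⟨j, hj⟩ := Function.ne_iff.1 A.rep_nonzero
  refine ⟨j, fun i => (A.rep j)⁻¹ * A.rep (j.succAbove i), A.rep j, hj, ?_⟩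
  funext i
  rw [Pi.zero_apply] at hj
  obtain rfl | ⟨l, rfl⟩ := j.eq_self_or_eq_succAbove i
  · simp
  · simp [hj]

theorem HasAffineCoordinates.eq_mk {A : Plane k} {j : Fin 3} {a : Fin 2 → k}
    (h : HasAffineCoordinates A j a) :
    A = Projectivization.mk k (chartVector j a) (chartVector_ne_zero j a) := by
  obtain ⟨c, hc, h⟩ := h
  rw [← A.mk_rep, Projectivization.mk_eq_mk_iff']
  exact ⟨c, h.symm⟩

theorem HasAffineCoordinates.extendPoint {L : Type u} [Field L] [Algebra k L] {A : Plane k}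
    {j : Fin 3} {a : Fin 2 → k} (h : HasAffineCoordinates A j a) :
    HasAffineCoordinates (extendPoint L A) j fun i => algebraMap k L (a i) := by
  have hA := h.eq_mk
  have hv : extendVector k L (chartVector j a) = chartVector j fun i => algebraMap k L (a i) := by
    funext i
    change algebraMap k L (chartVector j a i) = _
    obtain rfl | ⟨l, rfl⟩ := j.eq_self_or_eq_succAbove i <;> simp
  obtain ⟨c, hc⟩ := Projectivization.exists_smul_eq_mk_rep L
    (chartVector j fun i => algebraMap k L (a i)) (chartVector_ne_zero _ _)
  refine ⟨c, c.ne_zero, ?_⟩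
  have : BasePointMult.extendPoint L A = Projectivization.mk L
      (chartVector j fun i => algebraMap k L (a i)) (chartVector_ne_zero _ _) := by
    rw [hA, BasePointMult.extendPoint, Projectivization.map_mk]
    congr 1
  rw [this, ← hc]
  rfl

theorem eval_smul_of_isHomogeneous {σ : Type*} {f : MvPolynomial σ k} {d : ℕ}
    (hf : f.IsHomogeneous d) (c : k) (v : σ → k) : eval (c • v) f = c ^ d * eval v f := by
  have h := aeval_mul_of_isHomogeneous hf v c
  rw [aeval_eq_eval, aeval_eq_eval] at h
  rw [mul_comm (c ^ d)]
  refine Eq.trans ?_ h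
  congr 2
  funext i
  exact mul_comm _ _

theorem HasAffineCoordinates.eval_rep_eq_zero_iff {A : Plane k} {j : Fin 3} {a : Fin 2 → k}
    (h : HasAffineCoordinates A j a) {f : MvPolynomial (Fin 3) k} {d : ℕ}
    (hf : f.IsHomogeneous d) : eval A.rep f = 0 ↔ eval (chartVector j a) f = 0 := by
  obtain ⟨c, hc, h⟩ := h
  rw [h, eval_smul_of_isHomogeneous hf, mul_eq_zero, or_iff_right (pow_ne_zero _ hc)]

theorem eval_dehomogenize_zero (j : Fin 3) (a : Fin 2 → k) (f : MvPolynomial (Fin 3) k) :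
    eval a (dehomogenize j 0 f) = eval (chartVector j a) f := by
  have h := aeval_dehomogenize j (0 : Fin 2 → k) (chartVector j a) (chartVector_self j a) f
  rw [aeval_eq_eval, aeval_eq_eval] at h
  simpa using h

theorem constantCoeff_dehomogenize (j : Fin 3) (a : Fin 2 → k) (f : MvPolynomial (Fin 3) k) :
    constantCoeff (dehomogenize j a f) = eval (chartVector j a) f := by
  have h := aeval_dehomogenize j a (chartVector j a) (chartVector_self j a) f
  rw [aeval_eq_eval, aeval_eq_eval] at h
  rw [← eval_zero', ← h]
  congr 2
  funext i
  simp

theorem dehomogenize_map {L : Type*} [Field L] [Algebra k L] (j : Fin 3) (a : Fin 2 → k)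
    (f : MvPolynomial (Fin 3) k) :
    dehomogenize j (fun i => algebraMap k L (a i)) (map (algebraMap k L) f) =
      map (algebraMap k L) (dehomogenize j a f) := by
  induction f using MvPolynomial.induction_on with
  | C c => simp [algHom_C, algebraMap_eq]
  | add p q hp hq => simp only [map_add, hp, hq]
  | mul_X p i hp =>
    simp only [map_mul, hp, map_X]
    congr 1
    obtain rfl | ⟨l, rfl⟩ := j.eq_self_or_eq_succAbove i <;> simp

/-- Powers of `X j` equalize degrees in a sum and become `1` in the chart. -/
theorem exists_isHomogeneous_dehomogenize_eq (j : Fin 3) (a : Fin 2 → k)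
    (g : MvPolynomial (Fin 2) k) :
    ∃ (d : ℕ) (G : MvPolynomial (Fin 3) k), G.IsHomogeneous d ∧ dehomogenize j a G = g := by
  induction g using MvPolynomial.induction_on with
  | C c => exact ⟨0, C c, isHomogeneous_C _ _, by rw [algHom_C, algebraMap_eq]⟩
  | add p q hp hq =>
    obtain ⟨d, P, hP, rfl⟩ := hp
    obtain ⟨e, Q, hQ, rfl⟩ := hq
    refine ⟨d + e, P * X j ^ e + Q * X j ^ d, ?_, by simp⟩
    refine (hP.mul (isHomogeneous_X_pow j e)).add ?_
    rw [add_comm d e]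
    exact hQ.mul (isHomogeneous_X_pow j d)
  | mul_X p i hp =>
    obtain ⟨d, P, hP, rfl⟩ := hp
    refine ⟨d + 1, P * (X (j.succAbove i) - C (a i) * X j), ?_, by
      simp [algHom_C, algebraMap_eq]⟩
    exact hP.mul ((isHomogeneous_X k _).sub (isHomogeneous_C_mul_X _ _))

theorem eq_of_dehomogenize_eq {j : Fin 3} {a : Fin 2 → k} {f g : MvPolynomial (Fin 3) k} {n : ℕ}
    (hf : f.IsHomogeneous n) (hg : g.IsHomogeneous n)
    (h : dehomogenize j a f = dehomogenize j a g) : f = g := by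
  rw [← sub_eq_zero]
  refine eq_zero_of_dehomogenize_eq_zero (j := j) (a := a) (hf.sub hg) ?_
  rw [map_sub, h, sub_self]

/-- Dehomogenization preserves the absence of common factors. -/
theorem isUnit_of_forall_dvd_dehomogenize {ι : Type*} (p : ι → MvPolynomial (Fin 3) k) {n : ℕ}
    (hp : ∀ i, (p i).IsHomogeneous n) (hgcd : ∀ g, (∀ i, g ∣ p i) → IsUnit g) (j : Fin 3)
    (a : Fin 2 → k) (g : MvPolynomial (Fin 2) k) (hg : ∀ i, g ∣ dehomogenize j a (p i)) :
    IsUnit g := by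
  have hg0 : g ≠ 0 := by
    rintro rfl
    refine not_isUnit_zero (hgcd 0 fun i => ?_)
    rw [eq_zero_of_dehomogenize_eq_zero (hp i) (zero_dvd_iff.1 (hg i))]
  obtain ⟨d, G, hG, rfl⟩ := exists_isHomogeneous_dehomogenize_eq j a g
  have hG0 : G ≠ 0 := by
    rintro rfl
    exact hg0 (map_zero _)
  have hX : Irreducible (X j : MvPolynomial (Fin 3) k) := (X_prime (i := j)).irreducible
  -- `X j` is invisible in the chart, so only the part of `G` prime to it can be expected to divide
  -- the `p i`.
  obtain ⟨e, G', hG', rfl⟩ := WfDvdMonoid.max_power_factor hG0 hX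
  have hunit : IsUnit G' := by
    refine hgcd G' fun i => ?_
    obtain ⟨h, hh⟩ := hg i
    obtain ⟨m, H, hH, rfl⟩ := exists_isHomogeneous_dehomogenize_eq j a h
    -- Both sides are forms of degree `n + d + m` with the same dehomogenization.
    have heq : p i * X j ^ (d + m) = (X j ^ e * G') * H * X j ^ n := by
      refine eq_of_dehomogenize_eq (j := j) (a := a) (n := n + (d + m))
        ((hp i).mul (isHomogeneous_X_pow j _)) ?_ ?_
      · rw [add_comm n]
        exact (hG.mul hH).mul (isHomogeneous_X_pow j _)
      · rw [map_mul, hh]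
        simp
    have hdvd : G' ∣ p i * X j ^ (d + m) := ⟨X j ^ e * H * X j ^ n, by rw [heq]; ring⟩
    exact ((hX.isRelPrime_iff_not_dvd.2 hG').symm.pow_right).dvd_of_dvd_mul_right hdvd
  rw [map_mul, map_pow, dehomogenize_X_self, one_pow, one_mul]
  exact hunit.map _

end Chart

/-! ### Finiteness of the base locus -/

section Finiteness

variable {k : Type u} [Field k]

/-- The ideal of a common zero is a minimal prime over the ideal of the `q i`, because every prime
over that ideal is maximal; a noetherian ring has finitely many of them. -/
theorem finite_setOf_forall_eval_eq_zero {ι : Type*} (q : ι → MvPolynomial (Fin 2) k)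
    (hq : ∀ g, (∀ i, g ∣ q i) → IsUnit g) : {a : Fin 2 → k | ∀ i, eval a (q i) = 0}.Finite := by
  refine Set.Finite.of_finite_image (f := fun a => RingHom.ker (eval a))
    ((Ideal.finite_minimalPrimes_of_isNoetherianRing _ (Ideal.span (Set.range q))).subset ?_) ?_
  · rintro _ ⟨a, ha, rfl⟩
    have hprime : (RingHom.ker (eval a)).IsPrime := RingHom.ker_isPrime _
    have hle : Ideal.span (Set.range q) ≤ RingHom.ker (eval a) := by
      rw [Ideal.span_le]
      rintro _ ⟨i, rfl⟩
      exact ha i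
    obtain ⟨P, hP, hPle⟩ := Ideal.exists_minimalPrimes_le hle
    have := hP.1.1
    have hmax := isMaximal_of_forall_dvd_isUnit P q
      (fun i => hP.1.2 (Ideal.subset_span ⟨i, rfl⟩)) hq
    change RingHom.ker (eval a) ∈ _
    rw [← hmax.eq_of_le hprime.ne_top hPle]
    exact hP
  · intro a _ b _ hab
    funext i
    have : X i - C (a i) ∈ RingHom.ker (eval b) := by
      rw [← show RingHom.ker (eval a) = RingHom.ker (eval b) from hab, RingHom.mem_ker]
      simp
    rw [RingHom.mem_ker] at this
    simpa [sub_eq_zero, eq_comm] using this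

theorem finite_basePoints {p : Fin 4 → MvPolynomial (Fin 3) k} {n : ℕ}
    (hp : ∀ i, (p i).IsHomogeneous n)
    (hgcd : ∀ g : MvPolynomial (Fin 3) k, (∀ i, g ∣ p i) → IsUnit g) :
    (basePoints p).Finite := by
  refine (Set.finite_iUnion fun j : Fin 3 => (finite_setOf_forall_eval_eq_zero
    (fun i => dehomogenize j 0 (p i)) (isUnit_of_forall_dvd_dehomogenize p hp hgcd j 0)).image
      fun a => Projectivization.mk k (chartVector j a) (chartVector_ne_zero j a)).subset ?_
  intro A hA
  obtain ⟨j, a, h⟩ := exists_hasAffineCoordinates A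
  rw [Set.mem_iUnion]
  refine ⟨j, a, fun i => ?_, h.eq_mk.symm⟩
  rw [eval_dehomogenize_zero]
  exact (h.eval_rep_eq_zero_iff (hp i)).1 (hA i)

end Finiteness

/-! ### The local ring at a point as a localization of a chart -/

section LocalRing

variable {k : Type u} [Field k] {A : Plane k} {j : Fin 3} {a : Fin 2 → k}

theorem mem_pointIdeal_iff (A : Plane k) {f : MvPolynomial (Fin 3) k} {d : ℕ}
    (hf : f.IsHomogeneous d) : f ∈ (pointIdeal A).toIdeal ↔ eval A.rep f = 0 := by
  constructor
  · intro h
    exact Ideal.toIdeal_homogeneousCore_le _ _ h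
  · intro h
    exact Ideal.mem_homogeneousCore_of_homogeneous_of_mem ⟨d, hf⟩ h

theorem HasAffineCoordinates.mem_pointIdeal_iff (h : HasAffineCoordinates A j a)
    {f : MvPolynomial (Fin 3) k} {d : ℕ} (hf : f.IsHomogeneous d) :
    f ∈ (pointIdeal A).toIdeal ↔ dehomogenize j a f ∈ idealOfVars (Fin 2) k := by
  rw [BasePointMult.mem_pointIdeal_iff A hf, h.eval_rep_eq_zero_iff hf, mem_idealOfVars_iff,
    constantCoeff_dehomogenize]

theorem HasAffineCoordinates.X_pow_mem_primeCompl (h : HasAffineCoordinates A j a) (d : ℕ) :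
    (X j : MvPolynomial (Fin 3) k) ^ d ∈ (pointIdeal A).toIdeal.primeCompl := by
  rw [Ideal.mem_primeCompl_iff, h.mem_pointIdeal_iff (isHomogeneous_X_pow j d),
    mem_idealOfVars_iff]
  simp

/-- The fraction `f / s` in the local ring at `A`. -/
def localFraction (A : Plane k) {d : ℕ} {f s : MvPolynomial (Fin 3) k} (hf : f.IsHomogeneous d)
    (hs : s.IsHomogeneous d) (hsA : s ∈ (pointIdeal A).toIdeal.primeCompl) : LocalRingAt A :=
  HomogeneousLocalization.mk ⟨d, ⟨f, hf⟩, ⟨s, hs⟩, hsA⟩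

theorem val_localFraction {d : ℕ} {f s : MvPolynomial (Fin 3) k} (hf : f.IsHomogeneous d)
    (hs : s.IsHomogeneous d) (hsA : s ∈ (pointIdeal A).toIdeal.primeCompl) :
    (localFraction A hf hs hsA).val = Localization.mk f ⟨s, hsA⟩ :=
  HomogeneousLocalization.val_mk _

instance isScalarTower_localization (A : Plane k) :
    IsScalarTower k (LocalRingAt A) (Localization (pointIdeal A).toIdeal.primeCompl) :=
  IsScalarTower.of_algebraMap_eq (R := k) (S := LocalRingAt A)
      (A := Localization (pointIdeal A).toIdeal.primeCompl) fun c => by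
    rw [Algebra.algebraMap_eq_smul_one, Algebra.algebraMap_eq_smul_one (A := LocalRingAt A),
      HomogeneousLocalization.algebraMap_apply, HomogeneousLocalization.val_smul,
      HomogeneousLocalization.val_one]

/-- The affine coordinate ring of the `j`-th chart, with origin at `A`, maps to the local ring at
`A`. -/
def chartMap (h : HasAffineCoordinates A j a) : MvPolynomial (Fin 2) k →ₐ[k] LocalRingAt A :=
  aeval fun i => localFraction A (isHomogeneous_X k (j.succAbove i)) (isHomogeneous_X_pow j 1)
    (h.X_pow_mem_primeCompl 1) - algebraMap k _ (a i)

theorem chartMap_dehomogenize (h : HasAffineCoordinates A j a) {f : MvPolynomial (Fin 3) k} {d : ℕ}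
    (hf : f.IsHomogeneous d) :
    chartMap h (dehomogenize j a f) =
      localFraction A hf (isHomogeneous_X_pow j d) (h.X_pow_mem_primeCompl d) := by
  let θ : Fin 3 → LocalRingAt A := fun i => localFraction A (isHomogeneous_X k i)
    (isHomogeneous_X_pow j 1) (h.X_pow_mem_primeCompl 1)
  let τ : MvPolynomial (Fin 3) k →ₐ[k] Localization (pointIdeal A).toIdeal.primeCompl :=
    IsScalarTower.toAlgHom _ _ _
  have hτ (f : MvPolynomial (Fin 3) k) : τ f = Localization.mk f 1 :=
    (Localization.mk_one_eq_algebraMap f).symm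
  have hθτ (i : Fin 3) : (θ i).val * τ (X j) = τ (X i) := by
    simp only [θ]
    rw [val_localFraction, hτ, hτ, Localization.mk_mul, Localization.mk_eq_mk_iff,
      Localization.r_iff_exists]
    exact ⟨1, by simp [mul_comm]⟩
  have hθj : θ j = 1 := by
    apply HomogeneousLocalization.val_injective
    simp only [θ]
    rw [val_localFraction, HomogeneousLocalization.val_one, ← Localization.mk_one,
      Localization.mk_eq_mk_iff, Localization.r_iff_exists]
    exact ⟨1, by simp⟩
  have h1 : chartMap h (dehomogenize j a f) = aeval θ f := aeval_dehomogenize j a θ hθj f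
  rw [h1]
  apply HomogeneousLocalization.val_injective
  -- Denominators are cleared in the full localization, where `X j` itself is an element.
  have h2 : (aeval θ f).val * τ (X j) ^ d = τ f := by
    have h3 : (aeval θ f).val = aeval (fun i => (θ i).val) f := by
      rw [← HomogeneousLocalization.algebraMap_apply, ← aeval_algebraMap_apply]
      rfl
    rw [h3, ← aeval_mul_of_isHomogeneous hf]
    simp only [hθτ]
    exact DFunLike.congr_fun (aeval_unique τ).symm f
  rw [hτ, hτ, Localization.mk_pow] at h2
  rw [val_localFraction, Localization.mk_eq_mk', eq_comm, IsLocalization.mk'_eq_iff_eq_mul,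
    ← Localization.mk_one_eq_algebraMap, ← Localization.mk_one_eq_algebraMap]
  simpa using h2.symm

theorem exists_chartMap_eq (h : HasAffineCoordinates A j a) (g : MvPolynomial (Fin 2) k) :
    ∃ (d : ℕ) (G : MvPolynomial (Fin 3) k) (hG : G.IsHomogeneous d), dehomogenize j a G = g ∧
      chartMap h g =
        localFraction A hG (isHomogeneous_X_pow j d) (h.X_pow_mem_primeCompl d) := by
  obtain ⟨d, G, hG, rfl⟩ := exists_isHomogeneous_dehomogenize_eq j a g
  exact ⟨d, G, hG, rfl, chartMap_dehomogenize h hG⟩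

theorem chartMap_injective (h : HasAffineCoordinates A j a) : Function.Injective (chartMap h) := by
  rw [injective_iff_map_eq_zero]
  intro g hg
  obtain ⟨d, G, hG, rfl, hgG⟩ := exists_chartMap_eq h g
  rw [hgG] at hg
  have hval := congrArg HomogeneousLocalization.val hg
  rw [val_localFraction, HomogeneousLocalization.val_zero, Localization.mk_eq_mk',
    IsLocalization.mk'_eq_zero_iff] at hval
  obtain ⟨m, hm⟩ := hval
  have hm0 : (m : MvPolynomial (Fin 3) k) ≠ 0 := fun h0 => m.2 (h0 ▸ zero_mem _)
  rw [(mul_eq_zero.1 hm).resolve_left hm0, map_zero]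

theorem localFraction_mul_localFraction {d : ℕ} {f s t : MvPolynomial (Fin 3) k}
    (hf : f.IsHomogeneous d) (hs : s.IsHomogeneous d) (ht : t.IsHomogeneous d)
    (hsA : s ∈ (pointIdeal A).toIdeal.primeCompl) (htA : t ∈ (pointIdeal A).toIdeal.primeCompl) :
    localFraction A hf hs hsA * localFraction A hs ht htA = localFraction A hf ht htA := by
  apply HomogeneousLocalization.val_injective
  rw [HomogeneousLocalization.val_mul, val_localFraction, val_localFraction, val_localFraction,
    Localization.mk_mul, Localization.mk_eq_mk_iff, Localization.r_iff_exists]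
  refine ⟨1, ?_⟩
  simp only [OneMemClass.coe_one, Submonoid.coe_mul, one_mul]
  ring

theorem localFraction_self {d : ℕ} {s : MvPolynomial (Fin 3) k}
    (hs : s.IsHomogeneous d) (hsA : s ∈ (pointIdeal A).toIdeal.primeCompl) :
    localFraction A hs hs hsA = 1 := by
  apply HomogeneousLocalization.val_injective
  rw [val_localFraction, HomogeneousLocalization.val_one]
  exact Localization.mk_self (⟨s, hsA⟩ : (pointIdeal A).toIdeal.primeCompl)

theorem isUnit_localFraction {d : ℕ} {s t : MvPolynomial (Fin 3) k}
    (hs : s.IsHomogeneous d) (ht : t.IsHomogeneous d)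
    (hsA : s ∈ (pointIdeal A).toIdeal.primeCompl) (htA : t ∈ (pointIdeal A).toIdeal.primeCompl) :
    IsUnit (localFraction A hs ht htA) :=
  .of_mul_eq_one (localFraction A ht hs hsA) (by
    rw [localFraction_mul_localFraction, localFraction_self])

/-- The local ring at `A` as an algebra over the coordinate ring of an affine chart. -/
abbrev chartAlgebra (h : HasAffineCoordinates A j a) :
    Algebra (MvPolynomial (Fin 2) k) (LocalRingAt A) :=
  (chartMap h).toRingHom.toAlgebra

theorem isScalarTower_chartAlgebra (h : HasAffineCoordinates A j a) :
    letI := chartAlgebra h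
    IsScalarTower k (MvPolynomial (Fin 2) k) (LocalRingAt A) :=
  letI := chartAlgebra h
  IsScalarTower.of_algebraMap_eq fun c => ((chartMap h).commutes c).symm

theorem isLocalization_chartAlgebra (h : HasAffineCoordinates A j a) :
    letI := chartAlgebra h
    IsLocalization.AtPrime (LocalRingAt A) (idealOfVars (Fin 2) k) := by
  let := chartAlgebra h
  refine (isLocalization_iff _ _).2 ⟨?_, ?_, ?_⟩
  · rintro ⟨g, hg⟩
    obtain ⟨d, G, hG, rfl, hgG⟩ := exists_chartMap_eq h g
    change IsUnit (chartMap h _)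
    rw [hgG]
    refine isUnit_localFraction _ _ ?_ _
    rw [Ideal.mem_primeCompl_iff, h.mem_pointIdeal_iff hG]
    exact hg
  · intro z
    obtain ⟨⟨d, ⟨f, hf⟩, ⟨s, hs⟩, hsA⟩, rfl⟩ := HomogeneousLocalization.mk_surjective z
    replace hf : f.IsHomogeneous d := hf
    replace hs : s.IsHomogeneous d := hs
    refine ⟨(dehomogenize j a f, ⟨dehomogenize j a s, ?_⟩), ?_⟩
    · rw [Ideal.mem_primeCompl_iff, ← h.mem_pointIdeal_iff hs]
      exact hsA
    · change localFraction A hf hs hsA * chartMap h _ = chartMap h _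
      rw [chartMap_dehomogenize h hf, chartMap_dehomogenize h hs, localFraction_mul_localFraction]
  · intro x y hxy
    refine ⟨1, ?_⟩
    rw [chartMap_injective h hxy]

/-- Any local equation `f / s` is the multiple `(f / X j ^ d) * (X j ^ d / s)` of the one given by
the chart. -/
theorem localIdeal_eq_span (h : HasAffineCoordinates A j a) {S : Set (MvPolynomial (Fin 3) k)}
    (hS : ∀ f ∈ S, ∃ d, f.IsHomogeneous d) :
    localIdeal A S = Ideal.span ((fun f => chartMap h (dehomogenize j a f)) '' S) := by
  refine le_antisymm (Ideal.span_le.2 ?_) (Ideal.span_le.2 ?_)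
  · rintro z ⟨f, hfS, d, hf, ⟨s, hs⟩, hsA, rfl⟩
    have hz : localFraction A hf (isHomogeneous_X_pow j d) (h.X_pow_mem_primeCompl d) *
        localFraction A (isHomogeneous_X_pow j d) hs hsA = localFraction A hf hs hsA :=
      localFraction_mul_localFraction _ _ _ _ _
    change localFraction A hf hs hsA ∈ _
    rw [← hz, ← chartMap_dehomogenize h hf]
    exact Ideal.mul_mem_right _ _ (Ideal.subset_span ⟨f, hfS, rfl⟩)
  · rintro _ ⟨f, hfS, rfl⟩
    obtain ⟨d, hf⟩ := hS f hfS
    exact Ideal.subset_span ⟨f, hfS, d, hf, ⟨X j ^ d, isHomogeneous_X_pow j d⟩,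
      h.X_pow_mem_primeCompl d, chartMap_dehomogenize h hf⟩

end LocalRing

/-! ### The multiplicity of a base point -/

section BasePoint

variable {K : Type u} [Field K]

theorem algebraicIndependent_indeterminate :
    AlgebraicIndependent K (indeterminate K) := by
  let τ : MvPolynomial (Fin 4 ⊕ Fin 4) K →ₐ[K] GenericField K :=
    (IsScalarTower.toAlgHom K (FractionRing (MvPolynomial (Fin 4 ⊕ Fin 4) K))
      (GenericField K)).comp (IsScalarTower.toAlgHom K _ _)
  have hτ : Function.Injective τ :=
    (algebraMap (FractionRing (MvPolynomial (Fin 4 ⊕ Fin 4) K)) (GenericField K)).injective.comp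
      (IsFractionRing.injective (MvPolynomial (Fin 4 ⊕ Fin 4) K)
        (FractionRing (MvPolynomial (Fin 4 ⊕ Fin 4) K)))
  exact (algebraicIndependent_X (Fin 4 ⊕ Fin 4) K).map' (f := τ) hτ

theorem dehomogenize_genericCombination (p : Fin 4 → MvPolynomial (Fin 3) K)
    {F : Type*} [Field F] [Algebra K F] (x : Fin 4 → F) (j : Fin 3) (a : Fin 2 → K) :
    dehomogenize j (fun i => algebraMap K F (a i)) (∑ i, C (x i) * map (algebraMap K F) (p i)) =
      ∑ i, C (x i) * map (algebraMap K F) (dehomogenize j a (p i)) := by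
  simp only [map_sum, map_mul, dehomogenize_map, algHom_C, algebraMap_eq]

theorem isHomogeneous_genericCombination {p : Fin 4 → MvPolynomial (Fin 3) K} {n : ℕ}
    (hp : ∀ i, (p i).IsHomogeneous n) {F : Type*} [Field F] [Algebra K F] (x : Fin 4 → F) :
    (∑ i, C (x i) * map (algebraMap K F) (p i)).IsHomogeneous n :=
  IsHomogeneous.sum _ _ _ fun i _ => (hp i).map _ |>.C_mul _

theorem exists_hasHilbertSamuelMultiplicity_baseIdeal
    {p : Fin 4 → MvPolynomial (Fin 3) K} {n : ℕ} (hp : ∀ i, (p i).IsHomogeneous n)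
    (hgcd : ∀ g : MvPolynomial (Fin 3) K, (∀ i, g ∣ p i) → IsUnit g)
    {A : Plane K} (hA : A ∈ basePoints p) :
    ∃ e : ℕ, HasHilbertSamuelMultiplicity (baseIdeal p A) e ∧ basePointMultiplicity p A = e := by
  obtain ⟨j, a, h⟩ := exists_hasAffineCoordinates A
  -- The same affine coordinates serve over `K` and over `F`, so `extendScalars` at the origin links
  -- the two local rings.
  have h' := h.extendPoint (L := GenericField K)
  let := chartAlgebra h
  let := chartAlgebra h'
  have := isScalarTower_chartAlgebra h
  have := isScalarTower_chartAlgebra h'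
  have := isLocalization_chartAlgebra h
  have := isLocalization_chartAlgebra h'
  let r : Fin 4 → LocalRingAt A := fun i => algebraMap _ _ (dehomogenize j a (p i))
  have hr (i : Fin 4) : r i ∈ IsLocalRing.maximalIdeal (LocalRingAt A) := by
    rw [IsLocalization.AtPrime.to_map_mem_maximal_iff _ (idealOfVars (Fin 2) K),
      ← h.mem_pointIdeal_iff (hp i), mem_pointIdeal_iff A (hp i)]
    exact hA i
  obtain ⟨s, hs⟩ := exists_maximalIdeal_pow_le (LocalRingAt A) _
    (isUnit_of_forall_dvd_dehomogenize p hp hgcd j a)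
  have hW (x : Fin 4 → GenericField K) :
      chartMap h' (dehomogenize j (fun i => algebraMap K (GenericField K) (a i))
        (∑ i, C (x i) * map (algebraMap K (GenericField K)) (p i))) =
      ∑ i, algebraMap (GenericField K) _ (x i) *
        extendScalars K (GenericField K) (LocalRingAt A)
          (LocalRingAt (extendPoint (GenericField K) A)) (r i) := by
    rw [dehomogenize_genericCombination, map_sum]
    refine Finset.sum_congr rfl fun i _ => ?_
    rw [map_mul, algHom_C, extendScalars_algebraMap]
    rfl
  obtain ⟨e, he, hrank⟩ := exists_hasHilbertSamuelMultiplicity_of_generic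
    algebraicIndependent_indeterminate hr hs
    (hW fun i => indeterminate K (Sum.inl i)) (hW fun i => indeterminate K (Sum.inr i))
  refine ⟨e, ?_, ?_⟩
  · rw [baseIdeal, localIdeal_eq_span h (by rintro _ ⟨i, rfl⟩; exact ⟨n, hp i⟩),
      ← Set.range_comp]
    exact he
  · rw [basePointMultiplicity, intersectionMultiplicity, localIdeal_eq_span h' (by
      rintro _ (rfl | rfl)
      · exact ⟨n, isHomogeneous_genericCombination hp _⟩
      · exact ⟨n, isHomogeneous_genericCombination hp _⟩), Set.image_pair]
    exact (congrArg Cardinal.toENat hrank).trans (map_natCast _ e)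

end BasePoint

end

end BasePointMult

theorem mainTheorem4 {K : Type u} [Field K] [IsAlgClosed K] [CharZero K]
    (p : Fin 4 → MvPolynomial (Fin 3) K) (n : ℕ) (hp : ∀ i, (p i).IsHomogeneous n)
    (hgcd : ∀ g : MvPolynomial (Fin 3) K, (∀ i, g ∣ p i) → IsUnit g) :
    (BasePointMult.basePoints p).Finite ∧
    (∀ A ∈ BasePointMult.basePoints p,
      BasePointMult.HasHilbertSamuelMultiplicity (BasePointMult.baseIdeal p A)
        (BasePointMult.hilbertSamuelMultiplicity (BasePointMult.baseIdeal p A)) ∧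
      (BasePointMult.hilbertSamuelMultiplicity (BasePointMult.baseIdeal p A) : ℕ∞) =
        BasePointMult.basePointMultiplicity p A) ∧
    BasePointMult.baseLocusMultiplicity p =
      ∑ᶠ A ∈ BasePointMult.basePoints p,
        (BasePointMult.hilbertSamuelMultiplicity (BasePointMult.baseIdeal p A) : ℕ∞) := by

  have hmult (A) (hA : A ∈ BasePointMult.basePoints p) :
      BasePointMult.HasHilbertSamuelMultiplicity (BasePointMult.baseIdeal p A)
        (BasePointMult.hilbertSamuelMultiplicity (BasePointMult.baseIdeal p A)) ∧
      (BasePointMult.hilbertSamuelMultiplicity (BasePointMult.baseIdeal p A) : ℕ∞) =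
        BasePointMult.basePointMultiplicity p A := by
    obtain ⟨e, he, hmult⟩ := BasePointMult.exists_hasHilbertSamuelMultiplicity_baseIdeal hp hgcd hA
    rw [he.eq]
    exact ⟨he, hmult.symm⟩
  exact ⟨BasePointMult.finite_basePoints hp hgcd, hmult,
    finsum_mem_congr rfl fun A hA => (hmult A hA).2.symm⟩
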